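/- **Characterisation of encodings of semisimple algebras.** Let $\mathcal A\cong\bigoplus_{j=1}^{l} M_{n_j}(\mathbb C)$ and $\mathcal B\cong\bigoplus_{i=1}^{k} M_{m_i}(\mathbb C)$ be finite-dimensional $C^*$-algebras with fixed $*$-isomorphic decompositions, all $n_j,m_i\ge 1$. A special JB algebra $A\subseteq\mathcal A$ is a real linear subspace of self-adjoint elements that contains $1$ and is closed under $a\circ b=\tfrac12(ab+ba)$, with the norm of $\mathcal A$; similarly $B\subseteq\mathcal B$. An encoding $\gamma:A\to B$ is a map with $\mathrm{spec}(\gamma(a))=\mathrm{spec}(a)$ and $\gamma(ta_1+(1-t)a_2)=t\gamma(a_1)+(1-t)\gamma(a_2)$ for all $a,a_1,a_2\in A$, $t\in[0,1]$. For $p_{ij},q_{ij}\in\mathbb N_0$ say that a map $\Gamma:\mathcal A\to\mathcal B$ *has multiplicities* $(p_{ij},q_{ij})$ if there are unitaries $U_i\in M_{m_i}(\mathbb C)$ such that for all $\alpha=(\alpha_1,\dots,\alpha_l)\in\mathcal A$ and all $i$ the $i$-th component of $\Gamma(\alpha)$ is $$\Gamma(\alpha)_i=U_i\Big(\bigoplus_{j}\big(\alpha_j^{\oplus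 p_{ij}}\oplus\bar\alpha_j^{\oplus q_{ij}}\big)\Big)U_i^\dagger ,$$ where $\bar\alpha_j$ is the entrywise complex conjugate. 1. Let $\gamma:A\to B$ be an encoding. Every unital $*$-preserving ring homomorphism $\Gamma:\mathcal A\to\mathcal B$ that extends $\gamma$ has multiplicities $(p_{ij},q_{ij})$ for some $p_{ij},q_{ij}\in\mathbb N_0$ with $\sum_j(p_{ij}+q_{ij})\,n_j=m_i$ for every $i$. If $A$ is the set of all self-adjoint elements of $\mathcal A$, then moreover for every $j$ there is an $i$ with $p_{ij}+q_{ij}>0$. 2. Let $\gamma:A\to B$ be an encoding, where $A$ is the set of all self-adjoint elements of $\mathcal A$. Then $\gamma$ extends to a unital $*$-preserving ring homomorphism $\mathcal A\to\mathcal B$. Any unital ring homomorphism extending $\gamma$ that preserves $*$ on the summands with $n_j=1$ preserves $*$ everywhere. If all $n_j\ge2$, then $\gamma$ has exactly one extension to a unital ring homomorphism $\mathcal A\to\mathcal B$. 3. Conversely, let $p_{ij},q_{ij}\in\mathbb N_0$ satisfy $\sum_j(p_{ij}+q_{ij})n_j=m_i$ for every $i$, and suppose that for every $j$ there is an $i$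 with $p_{ij}+q_{ij}>0$. Then there is a map $\mathcal A\to\mathcal B$ with multiplicities $(p_{ij},q_{ij})$, and every such map is a unital $*$-preserving ring homomorphism whose restriction to the self-adjoint elements of $\mathcal A$ is an encoding into the self-adjoint elements of $\mathcal B$. So different summands (superselection sectors) may be embedded with different multiplicities. -/

import Mathlib

open scoped Matrix

/-- A special JB algebra, realised inside a C*-algebra `𝒜`: a real linear subspace of self-adjoint
elements which contains the unit and is closed under the Jordan product
`a ∘ b = (a b + b a) / 2`. It carries the norm of `𝒜`; see `SpecialJBAlgebra.norm_axioms`. -/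
structure SpecialJBAlgebra (𝒜 : Type*) [CStarAlgebra 𝒜] extends Submodule ℝ 𝒜 where
  one_mem' : (1 : 𝒜) ∈ carrier
  jordan_mem' : ∀ {a b : 𝒜}, a ∈ carrier → b ∈ carrier →
    (1 / 2 : ℝ) • (a * b + b * a) ∈ carrier
  isSelfAdjoint' : ∀ {a : 𝒜}, a ∈ carrier → IsSelfAdjoint a

namespace SpecialJBAlgebra

/-- The elements of a special JB algebra, as a type. -/
abbrev Elt {𝒜 : Type*} [CStarAlgebra 𝒜] (A : SpecialJBAlgebra 𝒜) : Type _ := A.toSubmodule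

/-- The special JB algebra of all self-adjoint elements of a C*-algebra. -/
def full (𝒜 : Type*) [CStarAlgebra 𝒜] : SpecialJBAlgebra 𝒜 where
  carrier := {a | IsSelfAdjoint a}
  add_mem' := fun ha hb => IsSelfAdjoint.add ha hb
  zero_mem' := IsSelfAdjoint.zero 𝒜
  smul_mem' := fun c _ ha => IsSelfAdjoint.smul (IsSelfAdjoint.all c) ha
  one_mem' := IsSelfAdjoint.one 𝒜
  jordan_mem' := by
    intro a b ha hb
    refine IsSelfAdjoint.smul (IsSelfAdjoint.all _) ?_
    have ha' : star a = a := ha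
    have hb' : star b = b := hb
    change star (a * b + b * a) = a * b + b * a
    rw [star_add, star_mul, star_mul, ha', hb', add_comm]
  isSelfAdjoint' := fun ha => ha

/-- The inherited norm satisfies the three JB axioms. -/
theorem norm_axioms {𝒜 : Type*} [CStarAlgebra 𝒜] (A : SpecialJBAlgebra 𝒜) (a b : A.Elt) :
    ‖(1 / 2 : ℝ) • ((a : 𝒜) * b + b * a)‖ ≤ ‖(a : 𝒜)‖ * ‖(b : 𝒜)‖ ∧
    ‖(a : 𝒜) ^ 2‖ = ‖(a : 𝒜)‖ ^ 2 ∧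
    ‖(a : 𝒜) ^ 2‖ ≤ ‖(a : 𝒜) ^ 2 + (b : 𝒜) ^ 2‖ := by
  have ha : IsSelfAdjoint (a : 𝒜) := A.isSelfAdjoint' a.2
  have hb : IsSelfAdjoint (b : 𝒜) := A.isSelfAdjoint' b.2
  refine ⟨?_, ?_, ?_⟩
  · rw [norm_smul]
    have h1 := norm_add_le ((a : 𝒜) * b) (b * a)
    have h2 := norm_mul_le (a : 𝒜) b
    have h3 := norm_mul_le (b : 𝒜) a
    norm_num
    nlinarith
  · rw [sq, sq, IsSelfAdjoint.norm_mul_self ha, sq]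
  · let _ := CStarAlgebra.spectralOrder 𝒜
    let _ := CStarAlgebra.spectralOrderedRing 𝒜
    refine CStarAlgebra.norm_le_norm_of_nonneg_of_le ?_ ?_
    · exact ha.sq_nonneg
    · exact le_add_of_nonneg_right hb.sq_nonneg

end SpecialJBAlgebra

/-- An encoding between special JB algebras: a map that preserves spectra and convex
combinations. -/
structure IsEncoding {𝒜 ℬ : Type*} [CStarAlgebra 𝒜] [CStarAlgebra ℬ]
    {A : SpecialJBAlgebra 𝒜} {B : SpecialJBAlgebra ℬ} (γ : A.Elt → B.Elt) : Prop where
  spectrum_eq : ∀ a : A.Elt, spectrum ℂ (γ a : ℬ) = spectrum ℂ (a : 𝒜)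
  convex : ∀ (a₁ a₂ : A.Elt) (t : ℝ), 0 ≤ t → t ≤ 1 →
    γ (t • a₁ + (1 - t) • a₂) = t • γ a₁ + (1 - t) • γ a₂

/-- The direct sum of full matrix algebras `M_{n 0}(ℂ) ⊕ ⋯ ⊕ M_{n (l-1)}(ℂ)`. -/
abbrev MatrixSum {l : ℕ} (n : Fin l → ℕ) : Type :=
  ∀ j : Fin l, Matrix (Fin (n j)) (Fin (n j)) ℂ

/-- Index set of the matrix `⊕ⱼ (αⱼ^{⊕ pⱼ} ⊕ ᾱⱼ^{⊕ qⱼ})`. -/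
abbrev CopyIndex {l : ℕ} (n p q : Fin l → ℕ) : Type :=
  Σ j : Fin l, (Fin (n j) × Fin (p j)) ⊕ (Fin (n j) × Fin (q j))

/-- The block diagonal matrix `⊕ⱼ (αⱼ^{⊕ pⱼ} ⊕ ᾱⱼ^{⊕ qⱼ})`, where the bar is entrywise complex
conjugation. -/
noncomputable def copies {l : ℕ} {n : Fin l → ℕ} (p q : Fin l → ℕ) (α : MatrixSum n) :
    Matrix (CopyIndex n p q) (CopyIndex n p q) ℂ :=
  Matrix.blockDiagonal' fun j =>
    Matrix.fromBlocks
      (Matrix.blockDiagonal fun _ : Fin (p j) => α j) 0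
      0 (Matrix.blockDiagonal fun _ : Fin (q j) => (α j).map (starRingEnd ℂ))

/-- With respect to decompositions `Φ` of `𝒜` and `Ψ` of `ℬ`, the `i`-th component of `Γ α` is,
up to a unitary `U i` (and a numbering `e i` of the basis), `⊕ⱼ (αⱼ^{⊕ p i j} ⊕ ᾱⱼ^{⊕ q i j})`. -/
def HasCopiesForm {𝒜 ℬ : Type*} [CStarAlgebra 𝒜] [CStarAlgebra ℬ]
    {l k : ℕ} {n : Fin l → ℕ} {m : Fin k → ℕ}
    (Φ : 𝒜 ≃⋆ₐ[ℂ] MatrixSum n) (Ψ : ℬ ≃⋆ₐ[ℂ] MatrixSum m)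
    (p q : Fin k → Fin l → ℕ) (Γ : 𝒜 → ℬ) : Prop :=
  ∃ (e : ∀ i : Fin k, CopyIndex n (p i) (q i) ≃ Fin (m i))
    (U : ∀ i : Fin k, Matrix (Fin (m i)) (Fin (m i)) ℂ),
    (∀ i, U i ∈ Matrix.unitaryGroup (Fin (m i)) ℂ) ∧
    ∀ (α : 𝒜) (i : Fin k),
      Ψ (Γ α) i =
        U i * Matrix.reindex (e i) (e i) (copies (p i) (q i) (Φ α)) * (U i)ᴴ

/-!
A self-adjoint element with finite spectrum is a real combination of orthogonal projections, and
projections and their orthogonality are visible in the spectrum (`p + q` is a projection exactly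
when `p ⟂ q`). So an encoding, which is real linear, preserves squares: on the full special JB
algebra its complex linear extension is a Jordan `*`-homomorphism. On each matrix block such a map
is the orthogonal sum of a `*`-homomorphism and a `*`-antihomomorphism, separated by the Peirce
corners of the images of the matrix units; replacing `aᵀ` by `ā`, which is the same matrix when
`a` is self-adjoint, turns the latter into a conjugate linear `*`-homomorphism.

Conversely a `*`-preserving ring homomorphism `Γ` extending an encoding is real linear, and the
projections `(1 ∓ i Γ(i)) / 2` split it into a complex linear and a conjugate linear part. The
images of the matrix units under both parts form a complete family of systems of matrix units,
hence come from an orthonormal basis, and this is the unitary `U`. The rest is that an injective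
unital `*`-homomorphism of finite-dimensional algebras preserves spectra.

A ring homomorphism on blocks of size at least two is determined by its values on self-adjoint
elements, since `i e_rr` is then a product of self-adjoint matrices. Applied to `Γ` and
`x ↦ Γ(x⋆)⋆`, this also gives the compatibility with the involution.
-/

section RealSpectra

variable {𝒜 : Type*} [CStarAlgebra 𝒜] {a : 𝒜}

theorem eq_algebraMap_iff_spectrum_subset (ha : IsSelfAdjoint a) {c : ℝ} :
    a = algebraMap ℝ 𝒜 c ↔ spectrum ℝ a ⊆ {c} :=
  ⟨fun h => h ▸ CFC.spectrum_algebraMap_subset c,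
    fun h => CFC.eq_algebraMap_of_spectrum_subset_singleton a c h ha⟩

theorem exists_orthogonalIdempotents_eq_sum (ha : IsSelfAdjoint a)
    (hs : (spectrum ℝ a).Finite) :
    ∃ p : ℝ → 𝒜, OrthogonalIdempotents p ∧ (∀ x, IsSelfAdjoint (p x)) ∧
      a = ∑ x ∈ hs.toFinset, x • p x := by
  classical
  have hc (f : ℝ → ℝ) : ContinuousOn f (spectrum ℝ a) := hs.continuousOn f
  let δ (x y : ℝ) : ℝ := if y = x then 1 else 0
  refine ⟨fun x => cfc (δ x) a, OrthogonalIdempotents.iff_mul_eq.2 fun x y => ?_,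
    fun x => cfc_predicate _ a, ?_⟩
  · rw [← cfc_mul _ _ a (hc _) (hc _)]
    split_ifs with hxy
    · exact congrArg (cfc · a) (by ext z; simp [δ, hxy])
    · rw [← cfc_zero ℝ a]
      exact congrArg (cfc · a) (by ext z; by_cases hz : z = x <;> simp [δ, hz, hxy])
  · calc a = cfc (∑ x ∈ hs.toFinset, fun y => x • δ x y) a := by
          conv_lhs => rw [← cfc_id ℝ a]
          exact cfc_congr fun y hy => by simp [δ, hy]
      _ = ∑ x ∈ hs.toFinset, x • cfc (δ x) a := by
          rw [cfc_sum _ a _ fun _ _ => hc _]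
          exact Finset.sum_congr rfl fun x _ => cfc_smul x _ a (hc _)

end RealSpectra

theorem finite_spectrum_of_isIntegral {𝕜 R : Type*} [Field 𝕜] [Ring R] [Algebra 𝕜 R] {a : R}
    (ha : IsIntegral 𝕜 a) : (spectrum 𝕜 a).Finite := by
  nontriviality R
  refine ((minpoly 𝕜 a).rootSet_finite 𝕜).subset fun x hx => ?_
  have h0 : (minpoly 𝕜 a).eval x ∈ spectrum 𝕜 (0 : R) :=
    minpoly.aeval 𝕜 a ▸ spectrum.subset_polynomial_aeval a (minpoly 𝕜 a) ⟨x, hx, rfl⟩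
  rw [spectrum.zero_eq, Set.mem_singleton_iff] at h0
  simpa [Polynomial.mem_rootSet, minpoly.ne_zero ha] using h0

theorem sum_smul_mul_sum_smul_of_orthogonalIdempotents {𝕜 R ι : Type*} [CommSemiring 𝕜]
    [Semiring R] [Algebra 𝕜 R] {p : ι → R} (hp : OrthogonalIdempotents p) (s : Finset ι)
    (c d : ι → 𝕜) :
    (∑ i ∈ s, c i • p i) * ∑ i ∈ s, d i • p i = ∑ i ∈ s, (c i * d i) • p i := by
  classical
  simp +contextual [Finset.sum_mul_sum, hp.mul_eq, smul_smul, mul_comm]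

theorem mul_eq_zero_of_isIdempotentElem_add {R : Type*} [NonUnitalSemiring R] [IsCancelAdd R]
    [IsAddTorsionFree R] {p q : R} (hp : IsIdempotentElem p) (hq : IsIdempotentElem q)
    (hpq : IsIdempotentElem (p + q)) : p * q = 0 :=
  hp.mul_eq_zero_of_anticommute ((hp.add_iff hq).1 hpq)

section ConvexCombinations

variable {𝕜 E F : Type*} [Field 𝕜] [LinearOrder 𝕜] [IsStrictOrderedRing 𝕜]
  [AddCommGroup E] [Module 𝕜 E] [AddCommGroup F] [Module 𝕜 F] {f : E → F}

theorem map_smul_of_map_convexComb (h0 : f 0 = 0)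
    (h : ∀ x y (t : 𝕜), 0 ≤ t → t ≤ 1 → f (t • x + (1 - t) • y) = t • f x + (1 - t) • f y)
    {t : 𝕜} (ht : 0 ≤ t) (x : E) : f (t • x) = t • f x := by
  have contract {s : 𝕜} (hs0 : 0 ≤ s) (hs1 : s ≤ 1) (y : E) : f (s • y) = s • f y := by
    simpa [h0] using h y 0 s hs0 hs1
  rcases le_total t 1 with ht1 | ht1
  · exact contract ht ht1 x
  · have ht' : t ≠ 0 := (zero_lt_one.trans_le ht1).ne'
    rw [← inv_smul_eq_iff₀ ht', ← contract (inv_nonneg.2 ht) (inv_le_one_of_one_le₀ ht1),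
      inv_smul_smul₀ ht']

theorem map_add_of_map_convexComb (h0 : f 0 = 0)
    (h : ∀ x y (t : 𝕜), 0 ≤ t → t ≤ 1 → f (t • x + (1 - t) • y) = t • f x + (1 - t) • f y)
    (x y : E) : f (x + y) = f x + f y := by
  have two_smul_midpoint (z : E) : (2⁻¹ : 𝕜) • (2 : 𝕜) • z = z := inv_smul_smul₀ two_ne_zero z
  have := h ((2 : 𝕜) • x) ((2 : 𝕜) • y) 2⁻¹ (by positivity) (by norm_num)
  rw [show (1 - 2⁻¹ : 𝕜) = 2⁻¹ by norm_num, two_smul_midpoint, two_smul_midpoint] at this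
  rw [this, map_smul_of_map_convexComb h0 h zero_le_two,
    map_smul_of_map_convexComb h0 h zero_le_two, inv_smul_smul₀ two_ne_zero,
    inv_smul_smul₀ two_ne_zero]

/-- A map that fixes the origin and preserves convex combinations, as a linear map. -/
def linearMapOfConvexComb (f : E → F) (h0 : f 0 = 0)
    (h : ∀ x y (t : 𝕜), 0 ≤ t → t ≤ 1 → f (t • x + (1 - t) • y) = t • f x + (1 - t) • f y) :
    E →ₗ[𝕜] F where
  toFun := f
  map_add' := map_add_of_map_convexComb h0 h
  map_smul' t x := by
    rcases le_total 0 t with ht | ht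
    · exact map_smul_of_map_convexComb h0 h ht x
    · have hadd := map_add_of_map_convexComb h0 h (t • x) (-t • x)
      rw [neg_smul, add_neg_cancel, h0, ← neg_smul,
        map_smul_of_map_convexComb h0 h (neg_nonneg.2 ht)] at hadd
      rw [RingHom.id_apply, eq_neg_of_add_eq_zero_left hadd.symm, neg_smul, neg_neg]

end ConvexCombinations

namespace IsEncoding

variable {𝒜 ℬ : Type*} [CStarAlgebra 𝒜] [CStarAlgebra ℬ]
  {A : SpecialJBAlgebra 𝒜} {B : SpecialJBAlgebra ℬ} {γ : A.Elt → B.Elt}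

theorem spectrum_real_eq (h : IsEncoding γ) (a : A.Elt) :
    spectrum ℝ (γ a : ℬ) = spectrum ℝ (a : 𝒜) := by
  rw [← spectrum.preimage_algebraMap (R := ℝ) ℂ (a := (a : 𝒜)),
    ← spectrum.preimage_algebraMap (R := ℝ) ℂ (a := (γ a : ℬ)), h.spectrum_eq]

theorem map_eq_algebraMap_iff (h : IsEncoding γ) {a : A.Elt} {c : ℝ} :
    (γ a : ℬ) = algebraMap ℝ ℬ c ↔ (a : 𝒜) = algebraMap ℝ 𝒜 c := by
  rw [eq_algebraMap_iff_spectrum_subset (B.isSelfAdjoint' (γ a).2),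
    eq_algebraMap_iff_spectrum_subset (A.isSelfAdjoint' a.2), h.spectrum_real_eq]

theorem map_eq_zero_iff (h : IsEncoding γ) {a : A.Elt} : γ a = 0 ↔ a = 0 := by
  simpa using h.map_eq_algebraMap_iff (a := a) (c := 0)

theorem map_isIdempotentElem (h : IsEncoding γ) {a : A.Elt} (ha : IsIdempotentElem (a : 𝒜)) :
    IsIdempotentElem (γ a : ℬ) := by
  have hspec := (isStarProjection_iff_spectrum_subset_and_isSelfAdjoint.1
    ⟨ha, A.isSelfAdjoint' a.2⟩).1
  rw [← h.spectrum_real_eq] at hspec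
  exact (isStarProjection_iff_spectrum_subset_and_isSelfAdjoint.2
    ⟨hspec, B.isSelfAdjoint' (γ a).2⟩).1

/-- An encoding as a real linear map. -/
noncomputable def toLinearMap (h : IsEncoding γ) : A.Elt →ₗ[ℝ] ℬ :=
  B.toSubmodule.subtype ∘ₗ linearMapOfConvexComb γ (h.map_eq_zero_iff.2 rfl) h.convex

@[simp]
theorem toLinearMap_apply (h : IsEncoding γ) (a : A.Elt) : h.toLinearMap a = γ a := rfl

theorem map_orthogonalIdempotents (h : IsEncoding γ) {ι : Type*} {p : ι → A.Elt}
    (hp : OrthogonalIdempotents fun i => (p i : 𝒜)) :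
    OrthogonalIdempotents fun i => (γ (p i) : ℬ) := by
  have : IsAddTorsionFree ℬ := .of_isTorsionFree ℝ ℬ
  refine ⟨fun i => h.map_isIdempotentElem (hp.idem i), fun i j hij => ?_⟩
  have hadd : IsIdempotentElem ((p i + p j : A.Elt) : 𝒜) :=
    (hp.idem i).add (hp.idem j) (by rw [hp.ortho hij, hp.ortho hij.symm, add_zero])
  refine mul_eq_zero_of_isIdempotentElem_add (h.map_isIdempotentElem (hp.idem i))
    (h.map_isIdempotentElem (hp.idem j)) ?_
  simpa only [← h.toLinearMap_apply, map_add] using h.map_isIdempotentElem hadd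

theorem map_mul_self [FiniteDimensional ℂ 𝒜] {γ : (SpecialJBAlgebra.full 𝒜).Elt → B.Elt}
    (h : IsEncoding γ) {a b : (SpecialJBAlgebra.full 𝒜).Elt}
    (hab : (b : 𝒜) = a * a) : (γ b : ℬ) = γ a * γ a := by
  have : FiniteDimensional ℝ 𝒜 := .complexToReal 𝒜
  have hs := finite_spectrum_of_isIntegral (Algebra.IsIntegral.isIntegral (R := ℝ) (a : 𝒜))
  obtain ⟨p, hp, hpsa, ha⟩ := exists_orthogonalIdempotents_eq_sum a.2 hs
  let P (x : ℝ) : (SpecialJBAlgebra.full 𝒜).Elt := ⟨p x, hpsa x⟩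
  have hP : OrthogonalIdempotents fun x => (γ (P x) : ℬ) := h.map_orthogonalIdempotents hp
  have γ_sum (c : ℝ → ℝ) {d : (SpecialJBAlgebra.full 𝒜).Elt}
      (hd : (d : 𝒜) = ∑ x ∈ hs.toFinset, c x • p x) :
      (γ d : ℬ) = ∑ x ∈ hs.toFinset, c x • (γ (P x) : ℬ) := by
    have : d = ∑ x ∈ hs.toFinset, c x • P x := Subtype.ext (by simp [hd, P])
    simp only [← h.toLinearMap_apply, this, map_sum, map_smul]
  have hb : (b : 𝒜) = ∑ x ∈ hs.toFinset, (x * x) • p x := by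
    rw [hab]
    conv_lhs => rw [ha]
    exact sum_smul_mul_sum_smul_of_orthogonalIdempotents hp _ _ _
  rw [γ_sum _ hb, γ_sum _ ha, sum_smul_mul_sum_smul_of_orthogonalIdempotents hP]

end IsEncoding

section ComplexExtension

variable {V W : Type*} [AddCommGroup V] [Module ℂ V] [StarAddMonoid V] [StarModule ℂ V]
  [AddCommGroup W] [Module ℂ W]

/-- The complex linear extension `x ↦ g (ℜ x) + i g (ℑ x)` of a real linear map `g` on the
self-adjoint elements. -/
noncomputable def complexExtension (g : selfAdjoint V →ₗ[ℝ] W) : V →ₗ[ℂ] W where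
  toFun x := g (realPart x) + Complex.I • g (imaginaryPart x)
  map_add' x y := by
    simp only [map_add, smul_add]
    abel
  map_smul' c x := by
    simp only [realPart_smul, imaginaryPart_smul, map_add, map_sub, map_smul, RingHom.id_apply,
      ← Complex.coe_smul]
    match_scalars <;> apply Complex.ext <;> simp

theorem complexExtension_apply_coe (g : selfAdjoint V →ₗ[ℝ] W) (a : selfAdjoint V) :
    complexExtension g a = g a := by
  simp [complexExtension]

end ComplexExtension

theorem mul_add_mul_eq_add_mul_self_sub {R : Type*} [NonUnitalNonAssocRing R] (x y : R) :
    x * y + y * x = (x + y) * (x + y) - x * x - y * y := by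
  rw [add_mul, mul_add, mul_add]
  abel

theorem add_I_smul_mul_self {R : Type*} [NonUnitalNonAssocRing R] [Module ℂ R]
    [IsScalarTower ℂ R R] [SMulCommClass ℂ R R] (a b : R) :
    (a + Complex.I • b) * (a + Complex.I • b) = a * a - b * b + Complex.I • (a * b + b * a) := by
  simp only [add_mul, mul_add, smul_mul_assoc, mul_smul_comm, smul_smul, Complex.I_mul_I, smul_add]
  module

theorem map_mul_add_mul_of_map_mul_self {S R F : Type*} [NonUnitalNonAssocRing S]
    [NonUnitalNonAssocRing R] [FunLike F S R] [AddMonoidHomClass F S R] (θ : F) {a b : S}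
    (ha : θ (a * a) = θ a * θ a) (hb : θ (b * b) = θ b * θ b)
    (hab : θ ((a + b) * (a + b)) = θ (a + b) * θ (a + b)) :
    θ (a * b + b * a) = θ a * θ b + θ b * θ a := by
  rw [mul_add_mul_eq_add_mul_self_sub, map_sub, map_sub, hab, ha, hb,
    mul_add_mul_eq_add_mul_self_sub (θ a), map_add]

/-- A complex linear Jordan `*`-homomorphism, the Jordan product being encoded by squares. -/
structure IsJordanStarHom {S R : Type*} [Ring S] [StarRing S] [Algebra ℂ S] [Ring R] [StarRing R]
    [Algebra ℂ R] (θ : S →ₗ[ℂ] R) : Prop where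
  map_mul_self : ∀ x, θ (x * x) = θ x * θ x
  map_star : ∀ x, θ (star x) = star (θ x)

namespace IsJordanStarHom

variable {S R : Type*} [Ring S] [StarRing S] [Algebra ℂ S] [Ring R] [StarRing R]
  [Algebra ℂ R] {θ : S →ₗ[ℂ] R}

theorem map_mul_add_mul (h : IsJordanStarHom θ) (x y : S) :
    θ (x * y + y * x) = θ x * θ y + θ y * θ x :=
  map_mul_add_mul_of_map_mul_self θ (h.map_mul_self x) (h.map_mul_self y) (h.map_mul_self (x + y))

theorem of_selfAdjoint [StarModule ℂ S] [StarModule ℂ R]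
    (hsa : ∀ a, IsSelfAdjoint a → IsSelfAdjoint (θ a))
    (hsq : ∀ a, IsSelfAdjoint a → θ (a * a) = θ a * θ a) : IsJordanStarHom θ := by
  constructor <;> intro x <;> rw [← realPart_add_I_smul_imaginaryPart x] <;>
    obtain ⟨a, ha⟩ := realPart x <;> obtain ⟨b, hb⟩ := imaginaryPart x
  · have hab := map_mul_add_mul_of_map_mul_self θ (hsq a ha) (hsq b hb) (hsq _ (ha.add hb))
    simp only [add_I_smul_mul_self, map_add, map_sub, map_smul, hsq a ha, hsq b hb, ← hab]
  · simp [selfAdjoint.mem_iff.1 ha, selfAdjoint.mem_iff.1 hb, (hsa a ha).star_eq,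
      (hsa b hb).star_eq]

end IsJordanStarHom

namespace IsEncoding

variable {𝒜 ℬ : Type*} [CStarAlgebra 𝒜] [CStarAlgebra ℬ] [FiniteDimensional ℂ 𝒜]
  {B : SpecialJBAlgebra ℬ} {γ : (SpecialJBAlgebra.full 𝒜).Elt → B.Elt}

theorem exists_isJordanStarHom (h : IsEncoding γ) :
    ∃ θ : 𝒜 →ₗ[ℂ] ℬ, IsJordanStarHom θ ∧
      ∀ a : (SpecialJBAlgebra.full 𝒜).Elt, θ a = γ a := by
  let θ : 𝒜 →ₗ[ℂ] ℬ := complexExtension (V := 𝒜) h.toLinearMap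
  have hθ (a : (SpecialJBAlgebra.full 𝒜).Elt) : θ (a : 𝒜) = γ a :=
    complexExtension_apply_coe (V := 𝒜) h.toLinearMap a
  refine ⟨θ, .of_selfAdjoint (fun a ha => ?_) (fun a ha => ?_), hθ⟩
  · exact hθ ⟨a, ha⟩ ▸ B.isSelfAdjoint' (γ ⟨a, ha⟩).2
  · have haa : IsSelfAdjoint (a * a) := by simpa only [pow_two] using ha.pow 2
    exact (hθ ⟨a * a, haa⟩).trans ((h.map_mul_self rfl).trans (by rw [← hθ ⟨a, ha⟩]))

end IsEncoding

/-- The multiplication table and involution of the standard matrix units `e r s`; the diagonal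
elements need not add up to one. -/
structure IsMatrixUnits {ι R : Type*} [DecidableEq ι] [NonUnitalNonAssocSemiring R] [Star R]
    (W : ι → ι → R) : Prop where
  mul_eq : ∀ r s t u, W r s * W t u = if s = t then W r u else 0
  star_eq : ∀ r s, star (W r s) = W s r

/-- Elements obeying the Jordan multiplication table and the involution of the standard matrix
units, as the images of the matrix units under a Jordan `*`-homomorphism do. -/
structure IsJordanMatrixUnits {ι R : Type*} [DecidableEq ι] [NonUnitalNonAssocSemiring R] [Star R]
    (E : ι → ι → R) : Prop where
  mul_add_mul : ∀ r s t u, E r s * E t u + E t u * E r s =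
    (if s = t then E r u else 0) + if u = r then E t s else 0
  star_eq : ∀ r s, star (E r s) = E s r

namespace IsJordanMatrixUnits

variable {ι R : Type*} [DecidableEq ι] [NonUnitalRing R] [StarRing R] {E : ι → ι → R}

theorem swap (h : IsJordanMatrixUnits E) : IsJordanMatrixUnits fun r s => E s r where
  mul_add_mul r s t u := by
    simp only [h.mul_add_mul s r u t, eq_comm (a := r), eq_comm (a := t), add_comm]
  star_eq r s := h.star_eq s r

theorem isMatrixUnits [Subsingleton ι] [IsAddTorsionFree R] (h : IsJordanMatrixUnits E) :
    IsMatrixUnits E where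
  mul_eq r s t u := by
    have := h.mul_add_mul r r r r
    obtain rfl := Subsingleton.elim r s
    obtain rfl := Subsingleton.elim r t
    obtain rfl := Subsingleton.elim r u
    simpa only [if_true, ← two_nsmul, nsmul_right_inj two_ne_zero] using this
  star_eq := h.star_eq

section Peirce

variable (h : IsJordanMatrixUnits E) {r s t : ι}
include h

theorem diag_mul_add_mul_diag (hrs : r ≠ s) : E r r * E r s + E r s * E r r = E r s := by
  rw [h.mul_add_mul, if_pos rfl, if_neg hrs.symm, add_zero]

theorem diag_mul_add_mul_diag' (hrs : r ≠ s) : E s s * E r s + E r s * E s s = E r s := by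
  rw [h.mul_add_mul, if_neg hrs.symm, if_pos rfl, zero_add]

variable [IsAddTorsionFree R]

theorem isIdempotentElem (r : ι) : IsIdempotentElem (E r r) := by
  have := h.mul_add_mul r r r r
  rwa [if_pos rfl, ← two_nsmul, ← two_nsmul, nsmul_right_inj two_ne_zero] at this

theorem mul_self_eq_zero (hrs : r ≠ s) : E r s * E r s = 0 := by
  have := h.mul_add_mul r s r s
  rwa [if_neg hrs.symm, add_zero, ← two_nsmul, nsmul_eq_zero_iff_right two_ne_zero] at this

theorem diag_mul_eq_zero (htr : t ≠ r) (hts : t ≠ s) : E t t * E r s = 0 :=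
  (h.isIdempotentElem t).mul_eq_zero_of_anticommute <| by
    rw [h.mul_add_mul, if_neg htr, if_neg hts.symm, add_zero]

theorem mul_diag_eq_zero (htr : t ≠ r) (hts : t ≠ s) : E r s * E t t = 0 := by
  simpa [h.star_eq] using congrArg star (h.diag_mul_eq_zero hts htr)

theorem diag_mul_eq_mul_diag (hrs : r ≠ s) : E r r * E r s = E r s * E s s := by
  have hpq : E r r * E s s = 0 := h.diag_mul_eq_zero hrs hrs
  calc E r r * E r s = E r r * E r s * E s s := by
        conv_lhs => rw [← h.diag_mul_add_mul_diag' hrs, mul_add, ← mul_assoc, hpq, zero_mul,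
          zero_add, ← mul_assoc]
    _ = E r s * E s s := by
        conv_rhs => rw [← h.diag_mul_add_mul_diag hrs, add_mul, mul_assoc (E r s), hpq, mul_zero,
          add_zero]

theorem mul_diag_mul_add_mul_diag_mul {o : ι} (hrs : r ≠ o ∨ s ≠ o) :
    E r o * E o o * E o s + E o s * E o o * E r o = E r s := by
  have hp (i : ι) : E i i * E i i = E i i := (h.isIdempotentElem i).eq
  rcases eq_or_ne r o with rfl | hro
  · have hs := hrs.resolve_left (not_not.2 rfl)
    rw [hp, mul_assoc, hp, h.diag_mul_add_mul_diag hs.symm]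
  rcases eq_or_ne s o with rfl | hso
  · rw [hp, mul_assoc, hp, add_comm, h.diag_mul_add_mul_diag' hro]
  rw [mul_assoc, mul_assoc, h.diag_mul_eq_mul_diag hso.symm, h.swap.diag_mul_eq_mul_diag hro.symm,
    ← mul_assoc, ← mul_assoc]
  have comm := h.mul_add_mul r o o s
  rw [if_pos rfl] at comm
  rcases eq_or_ne s r with rfl | hsr
  · rw [if_pos rfl] at comm
    rw [← add_mul, comm, add_mul, hp, h.diag_mul_eq_zero hro.symm hro.symm, add_zero]
  · rw [if_neg hsr, add_zero] at comm
    have right : E r o * E o s * E s s = E r s * E s s := by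
      rw [eq_sub_of_add_eq comm, sub_mul, mul_assoc (E o s), h.mul_diag_eq_zero hsr hso, mul_zero,
        sub_zero]
    have left : E o s * E r o * E r r = E r s * E r r := by
      rw [eq_sub_of_add_eq' comm, sub_mul, mul_assoc (E r o), h.mul_diag_eq_zero hro hsr.symm,
        mul_zero, sub_zero]
    rw [right, left, ← h.diag_mul_eq_mul_diag hsr.symm, h.diag_mul_add_mul_diag hsr.symm]

end Peirce

end IsJordanMatrixUnits

/-- For Jordan matrix units `E` and indices `o ≠ a`, the projection onto the part of the corner
`E o o` on which `E` multiplies like matrix units rather than like transposed matrix units. -/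
def homCorner {ι R : Type*} [Mul R] (E : ι → ι → R) (o a : ι) : R := E o o * E o a * E a o

/-- The matrix units carried by `homCorner E o a`. -/
def homUnits {ι R : Type*} [Mul R] (E : ι → ι → R) (o a r s : ι) : R :=
  E r o * homCorner E o a * E o s

namespace IsJordanMatrixUnits

variable {ι R : Type*} [DecidableEq ι] [NonUnitalRing R] [StarRing R] [IsAddTorsionFree R]
  {E : ι → ι → R} (h : IsJordanMatrixUnits E)
include h

theorem diag_mul_homCorner (o a : ι) : E o o * homCorner E o a = homCorner E o a := by
  simp only [homCorner, ← mul_assoc, (h.isIdempotentElem o).eq]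

variable {o a : ι} (hoa : o ≠ a)
include hoa

theorem homCorner_eq_mul_diag : homCorner E o a = E o a * E a o * E o o := by
  rw [homCorner, h.diag_mul_eq_mul_diag hoa, mul_assoc, h.diag_mul_eq_mul_diag hoa.symm, mul_assoc]

theorem star_homCorner : star (homCorner E o a) = homCorner E o a := by
  rw [h.homCorner_eq_mul_diag hoa, star_mul, star_mul, h.star_eq, h.star_eq, h.star_eq,
    ← mul_assoc, ← h.homCorner_eq_mul_diag hoa, homCorner]

theorem homCorner_mul_diag : homCorner E o a * E o o = homCorner E o a := by
  rw [h.homCorner_eq_mul_diag hoa, mul_assoc, (h.isIdempotentElem o).eq]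

theorem homCorner_mul_eq_zero {t : ι} (ht : t ≠ o) : homCorner E o a * E t o = 0 := by
  rcases eq_or_ne t a with rfl | hta
  · rw [homCorner, mul_assoc, h.mul_self_eq_zero ht, mul_zero]
  · have anticomm : E a o * E t o = -(E t o * E a o) := by
      rw [eq_neg_iff_add_eq_zero, h.mul_add_mul, if_neg ht.symm, if_neg hoa, add_zero]
    calc homCorner E o a * E t o = E o a * (E a a * (E a o * E t o)) := by
          rw [homCorner, h.diag_mul_eq_mul_diag hoa]
          simp only [mul_assoc]
      _ = -(E o a * (E a a * E t o * E a o)) := by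
          rw [anticomm, mul_neg, mul_neg, mul_assoc]
      _ = 0 := by rw [h.diag_mul_eq_zero hta.symm hoa.symm, zero_mul, mul_zero, neg_zero]

theorem mul_homCorner_eq_zero {s : ι} (hs : s ≠ o) : E o s * homCorner E o a = 0 := by
  simpa [h.star_eq, h.star_homCorner hoa] using congrArg star (h.homCorner_mul_eq_zero hoa hs)

theorem homCorner_mul_mul (s t : ι) :
    homCorner E o a * E o s * E t o = if s = t then homCorner E o a else 0 := by
  have expand : homCorner E o a * E o s * E t o = (if s = t then homCorner E o a else 0) +
      (homCorner E o a * E t s - homCorner E o a * E t o * E o s) := by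
    have := congrArg (homCorner E o a * ·) (h.mul_add_mul o s t o)
    simp only [mul_add, if_true, mul_ite, mul_zero, ← mul_assoc, h.homCorner_mul_diag hoa] at this
    rw [← add_sub_assoc, ← this, add_sub_cancel_right]
  have cancel : homCorner E o a * E t s - homCorner E o a * E t o * E o s = 0 := by
    rcases eq_or_ne t o with rfl | hto
    · rw [h.homCorner_mul_diag hoa, sub_self]
    · rw [h.homCorner_mul_eq_zero hoa hto, zero_mul, sub_zero]
      rcases eq_or_ne s o with rfl | hso
      · exact h.homCorner_mul_eq_zero hoa hto
      · rw [← h.homCorner_mul_diag hoa, mul_assoc, h.diag_mul_eq_zero hto.symm hso.symm, mul_zero]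
  rw [expand, cancel, add_zero]

theorem isIdempotentElem_homCorner : IsIdempotentElem (homCorner E o a) := by
  calc homCorner E o a * homCorner E o a = homCorner E o a * E o a * E a o * E o o := by
        rw [mul_assoc, mul_assoc, ← mul_assoc (E o a), ← h.homCorner_eq_mul_diag hoa]
    _ = homCorner E o a := by
        rw [h.homCorner_mul_mul hoa, if_pos rfl, h.homCorner_mul_diag hoa]

theorem isMatrixUnits_homUnits : IsMatrixUnits (homUnits E o a) where
  mul_eq r s t u := by
    calc homUnits E o a r s * homUnits E o a t u =
          E r o * (homCorner E o a * E o s * E t o) * homCorner E o a * E o u := by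
          simp only [homUnits, mul_assoc]
      _ = if s = t then homUnits E o a r u else 0 := by
          rw [h.homCorner_mul_mul hoa]
          split_ifs
          · rw [mul_assoc (E r o), (h.isIdempotentElem_homCorner hoa).eq, homUnits]
          · simp only [mul_zero, zero_mul]
  star_eq r s := by
    simp only [homUnits, star_mul, h.star_eq, h.star_homCorner hoa, mul_assoc]

theorem homCorner_add_homCorner_swap :
    homCorner E o a + homCorner (fun r s => E s r) o a = E o o := by
  rw [homCorner, homCorner, mul_assoc, mul_assoc, ← mul_add, h.mul_add_mul, if_pos rfl, if_pos rfl,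
    mul_add, (h.isIdempotentElem o).eq, h.diag_mul_eq_zero hoa hoa, add_zero]

theorem homCorner_mul_homCorner_swap :
    homCorner E o a * homCorner (fun r s => E s r) o a = 0 := by
  rw [eq_sub_of_add_eq' (h.homCorner_add_homCorner_swap hoa), mul_sub, h.homCorner_mul_diag hoa,
    (h.isIdempotentElem_homCorner hoa).eq, sub_self]

theorem homCorner_mul_eq_mul_diag (s : ι) :
    homCorner E o a * E o s = homCorner E o a * E o s * E s s := by
  rcases eq_or_ne s o with rfl | hs
  · rw [mul_assoc, (h.isIdempotentElem s).eq]
  · rw [← h.homCorner_mul_diag hoa, mul_assoc, mul_assoc, mul_assoc,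
      ← h.diag_mul_eq_mul_diag hs.symm, ← mul_assoc (E o o), (h.isIdempotentElem o).eq]

theorem homUnits_mul_homUnits_swap (r s t u : ι) :
    homUnits E o a r s * homUnits (fun r s => E s r) o a t u = 0 := by
  have corner : homCorner E o a * E o s * (E o t * homCorner (fun r s => E s r) o a) = 0 := by
    rcases eq_or_ne s t with rfl | hst
    · rcases eq_or_ne o s with rfl | hos
      · rw [h.homCorner_mul_diag hoa, ← mul_assoc, h.homCorner_mul_diag hoa,
          h.homCorner_mul_homCorner_swap hoa]
      · rw [mul_assoc, ← mul_assoc (E o s), h.mul_self_eq_zero hos, zero_mul, mul_zero]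
    · have diag_mul : E o t * homCorner (fun r s => E s r) o a =
          E t t * (E o t * homCorner (fun r s => E s r) o a) := by
        simpa [h.star_eq, h.swap.star_homCorner hoa] using
          congrArg star (h.swap.homCorner_mul_eq_mul_diag hoa t)
      rw [diag_mul, ← mul_assoc, h.homCorner_mul_eq_mul_diag hoa, mul_assoc _ (E s s) (E t t),
        h.diag_mul_eq_zero hst hst, mul_zero, zero_mul]
  calc homUnits E o a r s * homUnits (fun r s => E s r) o a t u =
        E r o * (homCorner E o a * E o s * (E o t * homCorner (fun r s => E s r) o a)) * E u o := by
        simp only [homUnits, mul_assoc]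
    _ = 0 := by rw [corner, mul_zero, zero_mul]

theorem homUnits_eq_mul_diag_mul {r s : ι} (h' : r ≠ o ∨ s ≠ o) :
    homUnits E o a r s = E r o * E o o * E o s := by
  have corner := eq_sub_of_add_eq (h.homCorner_add_homCorner_swap hoa)
  rcases h' with hr | hs
  · rw [homUnits, corner, mul_sub, h.swap.mul_homCorner_eq_zero hoa hr, sub_zero]
  · rw [homUnits, corner, mul_assoc, sub_mul, h.swap.homCorner_mul_eq_zero hoa hs, sub_zero,
      mul_assoc]

theorem homUnits_add_homUnits_swap (r s : ι) :
    homUnits E o a r s + homUnits (fun r s => E s r) o a s r = E r s := by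
  by_cases hrs : r ≠ o ∨ s ≠ o
  · rw [h.homUnits_eq_mul_diag_mul hoa hrs, h.swap.homUnits_eq_mul_diag_mul hoa hrs.symm,
      h.mul_diag_mul_add_mul_diag_mul hrs]
  · obtain ⟨rfl, rfl⟩ : r = o ∧ s = o := by simpa only [not_or, not_not] using hrs
    simp only [homUnits, h.diag_mul_homCorner, h.swap.diag_mul_homCorner, h.homCorner_mul_diag hoa,
      h.swap.homCorner_mul_diag hoa, h.homCorner_add_homCorner_swap hoa]

omit hoa in
theorem exists_isMatrixUnits_add : ∃ W W' : ι → ι → R, IsMatrixUnits W ∧ IsMatrixUnits W' ∧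
    (∀ r s t u, W r s * W' t u = 0) ∧ ∀ r s, W r s + W' s r = E r s := by
  rcases subsingleton_or_nontrivial ι with hι | hι
  · exact ⟨E, 0, h.isMatrixUnits, ⟨by simp, by simp⟩, by simp, by simp⟩
  · obtain ⟨o, a, hoa⟩ := exists_pair_ne ι
    exact ⟨homUnits E o a, homUnits (fun r s => E s r) o a, h.isMatrixUnits_homUnits hoa,
      h.swap.isMatrixUnits_homUnits hoa, h.homUnits_mul_homUnits_swap hoa,
      h.homUnits_add_homUnits_swap hoa⟩

end IsJordanMatrixUnits

/-- The sum of finitely many non-unital `*`-homomorphisms with mutually orthogonal ranges. -/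
def orthogonalSum {J 𝕜 S R : Type*} [Fintype J] [Monoid 𝕜] [NonUnitalNonAssocSemiring S] [Star S]
    [DistribMulAction 𝕜 S] [NonUnitalNonAssocSemiring R] [StarRing R] [DistribMulAction 𝕜 R]
    (f : J → S →⋆ₙₐ[𝕜] R) (hf : Pairwise fun i j => ∀ x y, f i x * f j y = 0) :
    S →⋆ₙₐ[𝕜] R where
  toFun x := ∑ j, f j x
  map_smul' c x := by simp [Finset.smul_sum]
  map_zero' := by simp
  map_add' x y := by simp [Finset.sum_add_distrib]
  map_mul' x y := by
    simp only [map_mul, Finset.sum_mul_sum]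
    exact Finset.sum_congr rfl fun i _ =>
      (Finset.sum_eq_single i (fun j _ hji => hf hji.symm x y) (by simp)).symm
  map_star' x := by simp [star_sum, map_star]

/-- A non-unital `*`-homomorphism that maps `1` to `1`, as a unital one. -/
def starAlgHomOfMapOne {𝕜 S R : Type*} [CommSemiring 𝕜] [Semiring S] [Star S] [Algebra 𝕜 S]
    [Semiring R] [Star R] [Algebra 𝕜 R] (f : S →⋆ₙₐ[𝕜] R) (h1 : f 1 = 1) : S →⋆ₐ[𝕜] R where
  __ := f
  map_one' := h1
  commutes' c := by
    change f (algebraMap 𝕜 S c) = algebraMap 𝕜 R c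
    rw [Algebra.algebraMap_eq_smul_one, map_smul, h1, Algebra.algebraMap_eq_smul_one]

theorem single_mul_single_of_ne {J : Type*} [DecidableEq J] {S : J → Type*}
    [∀ j, MulZeroClass (S j)] {i j : J} (hij : i ≠ j) (x : S i) (y : S j) :
    (Pi.single i x * Pi.single j y : ∀ j, S j) = 0 := by
  ext t
  rcases eq_or_ne t i with rfl | hti
  · simp [hij]
  · simp [hti]

/-- Entrywise complex conjugation `α ↦ ᾱ` of square matrices, a real `*`-homomorphism. -/
def entrywiseConj (ι : Type*) [Fintype ι] [DecidableEq ι] : Matrix ι ι ℂ →⋆ₐ[ℝ] Matrix ι ι ℂ where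
  toAlgHom := Complex.conjAe.toAlgHom.mapMatrix
  map_star' x := by ext; simp [Matrix.star_apply]

@[simp]
theorem entrywiseConj_apply {ι : Type*} [Fintype ι] [DecidableEq ι] (x : Matrix ι ι ℂ) :
    entrywiseConj ι x = x.map (starRingEnd ℂ) := rfl

namespace IsMatrixUnits

variable {𝕜 ι R : Type*} [CommSemiring 𝕜] [StarRing 𝕜] [Fintype ι] [DecidableEq ι]
  [NonUnitalSemiring R] [StarRing R] [Module 𝕜 R] [IsScalarTower 𝕜 R R] [SMulCommClass 𝕜 R R]
  [StarModule 𝕜 R] {W : ι → ι → R}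

/-- The `*`-homomorphism `x ↦ ∑ r s, x r s • W r s` given by a system of matrix units. -/
def toNonUnitalStarAlgHom (𝕜 : Type*) [CommSemiring 𝕜] [StarRing 𝕜] [Module 𝕜 R]
    [IsScalarTower 𝕜 R R] [SMulCommClass 𝕜 R R] [StarModule 𝕜 R] (h : IsMatrixUnits W) :
    Matrix ι ι 𝕜 →⋆ₙₐ[𝕜] R where
  toFun x := ∑ r, ∑ s, x r s • W r s
  map_smul' c x := by simp [mul_smul, Finset.smul_sum]
  map_zero' := by simp
  map_add' x y := by simp [add_smul, Finset.sum_add_distrib]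
  map_mul' x y := by
    have smul_mul_sum (r s : ι) : (x r s • W r s) * ∑ t, ∑ u, y t u • W t u =
        ∑ u, (x r s * y s u) • W r u := by
      simp only [Finset.mul_sum, smul_mul_smul_comm, h.mul_eq, smul_ite, smul_zero,
        Finset.sum_ite_irrel, Finset.sum_const_zero, Finset.sum_ite_eq, Finset.mem_univ, if_true]
    simp only [Finset.sum_mul, smul_mul_sum, Matrix.mul_apply, Finset.sum_smul]
    exact Finset.sum_congr rfl fun r _ => Finset.sum_comm
  map_star' x := by
    simp only [star_sum, star_smul, h.star_eq, Matrix.star_apply]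
    exact Finset.sum_comm

theorem toNonUnitalStarAlgHom_apply (h : IsMatrixUnits W) (x : Matrix ι ι 𝕜) :
    h.toNonUnitalStarAlgHom 𝕜 x = ∑ r, ∑ s, x r s • W r s := rfl

end IsMatrixUnits

namespace IsJordanStarHom

section MatrixAlgebra

variable {ι R : Type*} [Fintype ι] [DecidableEq ι] [Ring R] [StarRing R] [Algebra ℂ R]
  {θ : Matrix ι ι ℂ →ₗ[ℂ] R}

theorem isJordanMatrixUnits (h : IsJordanStarHom θ) :
    IsJordanMatrixUnits fun r s => θ (Matrix.single r s 1) where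
  mul_add_mul r s t u := by
    rw [← h.map_mul_add_mul, map_add]
    congr 1
    · rcases eq_or_ne s t with rfl | hst
      · simp
      · simp [hst]
    · rcases eq_or_ne u r with rfl | hur
      · simp
      · simp [hur]
  star_eq r s := by rw [← h.map_star, Matrix.star_eq_conjTranspose, Matrix.conjTranspose_single,
    star_one]

theorem exists_nonUnitalStarAlgHom [StarModule ℂ R] (h : IsJordanStarHom θ) :
    ∃ Γ : Matrix ι ι ℂ →⋆ₙₐ[ℝ] R, ∀ a, IsSelfAdjoint a → Γ a = θ a := by
  have : IsAddTorsionFree R := .of_isTorsionFree ℂ R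
  obtain ⟨W, W', hW, hW', hWW', hadd⟩ := h.isJordanMatrixUnits.exists_isMatrixUnits_add
  let g : Matrix ι ι ℂ →⋆ₙₐ[ℝ] R := (hW.toNonUnitalStarAlgHom ℂ).restrictScalars ℝ
  let g' : Matrix ι ι ℂ →⋆ₙₐ[ℝ] R := (hW'.toNonUnitalStarAlgHom ℂ).restrictScalars ℝ
  have hgg' (x y) : g x * g' y = 0 := by
    simp [g, g', IsMatrixUnits.toNonUnitalStarAlgHom_apply, Finset.sum_mul, Finset.mul_sum, hWW']
  have hW'W (r s t u) : W' r s * W t u = 0 := by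
    rw [← hW'.star_eq, ← hW.star_eq, ← star_mul, hWW', star_zero]
  have hg'g (x y) : g' x * g y = 0 := by
    simp [g, g', IsMatrixUnits.toNonUnitalStarAlgHom_apply, Finset.sum_mul, Finset.mul_sum, hW'W]
  let f (b : Bool) : Matrix ι ι ℂ →⋆ₙₐ[ℝ] R :=
    cond b g (g'.comp (entrywiseConj ι).toNonUnitalStarAlgHom)
  have hf : Pairwise fun b c => ∀ x y, f b x * f c y = 0 := by
    rintro (_ | _) (_ | _) hne x y
    exacts [absurd rfl hne, hg'g _ _, hgg' _ _, absurd rfl hne]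
  let Γ : Matrix ι ι ℂ →⋆ₙₐ[ℝ] R := orthogonalSum f hf
  refine ⟨Γ, fun a ha => ?_⟩
  have hconj : entrywiseConj ι a = aᵀ := by
    conv_lhs => rw [← ha.star_eq]
    ext; simp [Matrix.star_apply]
  calc Γ a = ∑ b, f b a := rfl
    _ = g a + g' aᵀ := by rw [Fintype.sum_bool, ← hconj]; rfl
    _ = ∑ r, ∑ s, a r s • W r s + ∑ r, ∑ s, a r s • W' s r := by
        rw [Finset.sum_comm (f := fun r s => a r s • W' s r)]
        rfl
    _ = θ a := by
        conv_rhs => rw [Matrix.matrix_eq_sum_single a]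
        simp only [← Finset.sum_add_distrib, ← smul_add, hadd, map_sum, ← map_smul,
          Matrix.smul_single, smul_eq_mul, mul_one]

end MatrixAlgebra

section MatrixSum

variable {J R : Type*} [DecidableEq J] {κ : J → Type*} [∀ j, Fintype (κ j)]
  [∀ j, DecidableEq (κ j)] [Ring R] [StarRing R] [Algebra ℂ R]
  {θ : (∀ j, Matrix (κ j) (κ j) ℂ) →ₗ[ℂ] R}

theorem comp_single (h : IsJordanStarHom θ) (j : J) :
    IsJordanStarHom (θ ∘ₗ LinearMap.single ℂ (fun j => Matrix (κ j) (κ j) ℂ) j) where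
  map_mul_self x := by simp [Pi.single_mul, h.map_mul_self]
  map_star x :=
    (congrArg θ (Pi.single_star (f := fun j => Matrix (κ j) (κ j) ℂ) j x)).trans (h.map_star _)

theorem orthogonalIdempotents_single_one (h : IsJordanStarHom θ) :
    OrthogonalIdempotents fun j => θ (Pi.single j 1) := by
  have : IsAddTorsionFree R := .of_isTorsionFree ℂ R
  have idem (j) : IsIdempotentElem (θ (Pi.single j 1)) := by
    rw [IsIdempotentElem, ← h.map_mul_self, ← Pi.single_mul, one_mul]
  refine ⟨idem, fun i j hij => (idem i).mul_eq_zero_of_anticommute ?_⟩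
  rw [← h.map_mul_add_mul, single_mul_single_of_ne hij, single_mul_single_of_ne hij.symm, add_zero,
    map_zero]

omit [DecidableEq J] in
theorem exists_starAlgHom [Finite J] [StarModule ℂ R] (h : IsJordanStarHom θ) (h1 : θ 1 = 1) :
    ∃ Γ : (∀ j, Matrix (κ j) (κ j) ℂ) →⋆ₐ[ℝ] R, ∀ a, IsSelfAdjoint a → Γ a = θ a := by
  classical
  cases nonempty_fintype J
  choose g hg using fun j => (h.comp_single j).exists_nonUnitalStarAlgHom
  have g_one (j) : g j 1 = θ (Pi.single j 1) := hg j 1 (.one _)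
  have orth : Pairwise fun i j => ∀ x y, g i x * g j y = 0 := fun i j hij x y => by
    rw [← mul_one x, ← one_mul y, map_mul, map_mul, mul_assoc, ← mul_assoc (g i 1), g_one, g_one,
      h.orthogonalIdempotents_single_one.ortho hij, zero_mul, mul_zero]
  let Γ : (∀ j, Matrix (κ j) (κ j) ℂ) →⋆ₙₐ[ℝ] R :=
    orthogonalSum (fun j => (g j).comp (Pi.evalStarAlgHom ℝ _ j).toNonUnitalStarAlgHom)
      fun i j hij x y => orth hij _ _
  have hΓ (a) (ha : IsSelfAdjoint a) : Γ a = θ a := by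
    calc Γ a = ∑ j, θ (Pi.single j (a j)) :=
          Finset.sum_congr rfl fun j _ => hg j (a j) (congrFun ha j)
      _ = θ a := by rw [← map_sum, Finset.univ_sum_single]
  exact ⟨starAlgHomOfMapOne Γ ((hΓ 1 (.one _)).trans h1), hΓ⟩

end MatrixSum

end IsJordanStarHom

section HomExt

open Matrix

theorem I_smul_single_one {ι : Type*} [Fintype ι] [DecidableEq ι] {r s : ι} (hrs : r ≠ s) :
    Complex.I • single r r (1 : ℂ) =
      (single r s 1 + single s r 1) * (Complex.I • (single s r 1 - single r s 1)) *
        single r r 1 := by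
  simp [add_mul, mul_sub, sub_mul, hrs, hrs.symm]

theorem nonUnitalRingHom_matrix_ext_of_selfAdjoint {ι R : Type*} [Fintype ι] [Nontrivial ι]
    [NonUnitalNonAssocSemiring R] {f g : Matrix ι ι ℂ →ₙ+* R}
    (h : ∀ a, IsSelfAdjoint a → f a = g a) : f = g := by
  classical
  have hI : f (Complex.I • 1) = g (Complex.I • 1) := by
    rw [← sum_single_one, Finset.smul_sum, map_sum, map_sum]
    refine Finset.sum_congr rfl fun r _ => ?_
    obtain ⟨s, hsr⟩ := exists_ne r
    rw [I_smul_single_one hsr.symm, map_mul, map_mul, map_mul, map_mul]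
    congr 1
    · congr 1 <;> apply h <;>
        simp [IsSelfAdjoint, star_eq_conjTranspose, add_comm, ← smul_neg]
    · exact h _ (by simp [IsSelfAdjoint, star_eq_conjTranspose])
  ext x : 1
  have hx : x = (realPart x : Matrix ι ι ℂ) + (Complex.I • 1) * imaginaryPart x := by
    rw [smul_one_mul, realPart_add_I_smul_imaginaryPart]
  rw [hx, map_add, map_add, map_mul, map_mul, hI, h _ (realPart x).2, h _ (imaginaryPart x).2]

variable {J R : Type*} [Finite J] [DecidableEq J] {κ : J → Type*} [∀ j, Fintype (κ j)]
  [∀ j, DecidableEq (κ j)] [NonAssocSemiring R]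

theorem ringHom_matrixSum_ext_of_selfAdjoint {f g : (∀ j, Matrix (κ j) (κ j) ℂ) →+* R}
    (h : ∀ a, IsSelfAdjoint a → f a = g a)
    (h' : ∀ j, Subsingleton (κ j) → ∀ z, f (Pi.single j z) = g (Pi.single j z)) : f = g := by
  cases nonempty_fintype J
  refine RingHom.ext fun x => ?_
  rw [← Finset.univ_sum_single x, map_sum, map_sum]
  refine Finset.sum_congr rfl fun j _ => ?_
  rcases subsingleton_or_nontrivial (κ j) with hj | hj
  · exact h' j hj _
  · let block : Matrix (κ j) (κ j) ℂ →ₙ+* ∀ j, Matrix (κ j) (κ j) ℂ :=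
      { AddMonoidHom.single (fun j => Matrix (κ j) (κ j) ℂ) j with
        map_mul' := Pi.single_mul (α := fun j => Matrix (κ j) (κ j) ℂ) j }
    have hfg : (f : _ →ₙ+* R).comp block = (g : _ →ₙ+* R).comp block :=
      nonUnitalRingHom_matrix_ext_of_selfAdjoint fun a ha =>
        h _ ((Pi.single_star (f := fun j => Matrix (κ j) (κ j) ℂ) j a).symm.trans
          (congrArg (Pi.single j) ha))
    exact DFunLike.congr_fun hfg (x j)

end HomExt

/-- The ring homomorphism `x ↦ (f x⋆)⋆`. It agrees with `f` exactly when `f` preserves the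
involution. -/
def starConj {S R : Type*} [Semiring S] [StarRing S] [Semiring R] [StarRing R] (f : S →+* R) :
    S →+* R where
  toFun x := star (f (star x))
  map_one' := by simp
  map_mul' x y := by simp
  map_zero' := by simp
  map_add' x y := by simp

@[simp]
theorem starConj_apply {S R : Type*} [Semiring S] [StarRing S] [Semiring R] [StarRing R]
    (f : S →+* R) (x : S) : starConj f x = star (f (star x)) := rfl

section LinearPart

variable {S R : Type*} [Ring S] [StarRing S] [Algebra ℝ S] [Algebra ℂ S] [Ring R] [StarRing R]
  [Algebra ℝ R]

theorem ofReal_smul_eq_smul {E : Type*} [SMul ℝ E] [MulAction ℂ E]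
    [IsScalarTower ℝ ℂ E] (r : ℝ) (x : E) : (r : ℂ) • x = r • x := by
  simpa only [Complex.real_smul, mul_one, one_smul] using smul_assoc r (1 : ℂ) x

theorem map_I_mul_map_I (φ : S →⋆ₐ[ℝ] R) : φ (Complex.I • 1) * φ (Complex.I • 1) = -1 := by
  rw [← map_mul, smul_mul_smul_comm, Complex.I_mul_I, mul_one, neg_one_smul, map_neg, map_one]

variable [Algebra ℂ R]

/-- The projection onto the complex linear (`true`) or conjugate linear (`false`) part of a real
`*`-homomorphism between complex algebras. -/
noncomputable def linearPart (φ : S →⋆ₐ[ℝ] R) (b : Bool) : R :=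
  (1 / 2 : ℂ) • (1 - cond b Complex.I (-Complex.I) • φ (Complex.I • 1))

variable (φ : S →⋆ₐ[ℝ] R)

theorem star_linearPart [StarModule ℂ S] [StarModule ℂ R] (b : Bool) :
    star (linearPart φ b) = linearPart φ b := by
  have hI : star (φ (Complex.I • 1)) = -φ (Complex.I • 1) := by
    rw [← map_star, ← map_neg]; simp
  cases b <;> simp [linearPart, hI]

theorem linearPart_mul (b c : Bool) :
    linearPart φ b * linearPart φ c = if b = c then linearPart φ b else 0 := by
  cases b <;> cases c <;>
  · simp only [linearPart, smul_mul_smul_comm, mul_sub, sub_mul, one_mul, mul_one,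
      map_I_mul_map_I, cond_true, cond_false, neg_mul, mul_neg, Complex.I_mul_I,
      if_true, reduceCtorEq, if_false]
    module

theorem linearPart_add : linearPart φ true + linearPart φ false = 1 := by
  simp only [linearPart, cond_true, cond_false]
  module

theorem map_mul_linearPart (b : Bool) (x : S) : φ x * linearPart φ b = linearPart φ b * φ x := by
  have hI : φ x * φ (Complex.I • 1) = φ (Complex.I • 1) * φ x := by
    rw [← map_mul, ← map_mul, mul_smul_one, smul_one_mul]
  simp only [linearPart, mul_smul_comm, smul_mul_assoc, mul_sub, sub_mul, mul_one, one_mul, hI]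

theorem linearPart_mul_map_I (b : Bool) :
    linearPart φ b * φ (Complex.I • 1) = cond b Complex.I (-Complex.I) • linearPart φ b := by
  have hc : cond b Complex.I (-Complex.I) * cond b Complex.I (-Complex.I) = -1 := by
    cases b <;> simp
  rw [linearPart, smul_mul_assoc, sub_mul, one_mul, smul_mul_assoc, map_I_mul_map_I, smul_comm,
    smul_sub (cond b _ _), smul_smul (cond b _ _), hc]
  module

theorem linearPart_mul_map_smul [IsScalarTower ℝ ℂ S] [IsScalarTower ℝ ℂ R] (b : Bool) (c : ℂ)
    (x : S) :
    linearPart φ b * φ (c • x) = cond b c (starRingEnd ℂ c) • (linearPart φ b * φ x) := by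
  have hc : c • x = c.re • x + c.im • ((Complex.I • 1) * x) := by
    conv_lhs => rw [← Complex.re_add_im c]
    rw [smul_one_mul, add_smul, mul_smul, ofReal_smul_eq_smul, ofReal_smul_eq_smul]
  rw [hc, map_add, map_smul, map_smul, map_mul, mul_add, mul_smul_comm, mul_smul_comm,
    ← mul_assoc, linearPart_mul_map_I, smul_mul_assoc,
    ← ofReal_smul_eq_smul, ← ofReal_smul_eq_smul, smul_smul, ← add_smul]
  cases b <;> congr 1 <;> simp [Complex.ext_iff]

end LinearPart

/-- A family of systems of matrix units with mutually orthogonal ranges whose diagonal elements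
together add up to one. -/
structure IsCompleteMatrixUnits {T R : Type*} {ι : T → Type*} [Fintype T] [∀ t, Fintype (ι t)]
    [∀ t, DecidableEq (ι t)] [NonAssocSemiring R] [Star R] (W : ∀ t, ι t → ι t → R) : Prop where
  isMatrixUnits : ∀ t, IsMatrixUnits (W t)
  mul_eq_zero : ∀ {t t'}, t ≠ t' → ∀ r s r' s', W t r s * W t' r' s' = 0
  sum_eq_one : ∑ t, ∑ r, W t r r = 1

section MatrixSum

variable {J R : Type*} [DecidableEq J] {κ : J → Type*} [∀ j, Fintype (κ j)]
  [∀ j, DecidableEq (κ j)] [Ring R] [StarRing R] [Algebra ℝ R]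
  [Algebra ℂ R]

/-- The matrix units of the complex linear and conjugate linear parts of a real `*`-homomorphism
on a sum of matrix algebras. -/
noncomputable def linearPartUnits (φ : (∀ j, Matrix (κ j) (κ j) ℂ) →⋆ₐ[ℝ] R) (t : J × Bool)
    (r s : κ t.1) : R :=
  linearPart φ t.2 * φ (Pi.single t.1 (Matrix.single r s 1))

variable (φ : (∀ j, Matrix (κ j) (κ j) ℂ) →⋆ₐ[ℝ] R)

theorem linearPartUnits_mul (t t' : J × Bool) (r s r' s') :
    linearPartUnits φ t r s * linearPartUnits φ t' r' s' = linearPart φ t.2 * linearPart φ t'.2 *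
      φ (Pi.single t.1 (Matrix.single r s 1) * Pi.single t'.1 (Matrix.single r' s' 1)) := by
  rw [linearPartUnits, linearPartUnits, map_mul, mul_assoc, ← mul_assoc (φ _), map_mul_linearPart]
  simp only [mul_assoc]

theorem isMatrixUnits_linearPartUnits [StarModule ℂ R] (t : J × Bool) :
    IsMatrixUnits (linearPartUnits φ t) where
  mul_eq r s s' u := by
    rw [linearPartUnits_mul, linearPart_mul, if_pos rfl, ← Pi.single_mul]
    split_ifs with hs
    · rw [hs, Matrix.single_mul_single_same, one_mul, linearPartUnits]
    · rw [Matrix.single_mul_single_of_ne _ _ _ _ hs, Pi.single_zero, map_zero, mul_zero]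
  star_eq r s := by
    rw [linearPartUnits, linearPartUnits, star_mul, star_linearPart, ← map_star,
      map_mul_linearPart, ← Pi.single_star, Matrix.star_eq_conjTranspose,
      Matrix.conjTranspose_single, star_one]

theorem sum_single_single_one [Fintype J] :
    ∑ j, ∑ r, (Pi.single j (Matrix.single r r 1) : ∀ j, Matrix (κ j) (κ j) ℂ) = 1 := by
  rw [← Finset.univ_sum_single (1 : ∀ j, Matrix (κ j) (κ j) ℂ)]
  refine Finset.sum_congr rfl fun j _ => ?_
  rw [Pi.one_apply, ← Matrix.sum_single_one]
  exact (map_sum (AddMonoidHom.single (fun j => Matrix (κ j) (κ j) ℂ) j) _ _).symm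

theorem isCompleteMatrixUnits_linearPartUnits [Fintype J] [StarModule ℂ R] :
    IsCompleteMatrixUnits (linearPartUnits φ) where
  isMatrixUnits := isMatrixUnits_linearPartUnits φ
  mul_eq_zero := by
    rintro ⟨j, b⟩ ⟨j', b'⟩ hne r s r' s'
    rw [linearPartUnits_mul, linearPart_mul]
    split_ifs with hb
    · rw [single_mul_single_of_ne fun hj => hne (Prod.ext hj hb), map_zero, mul_zero]
    · rw [zero_mul]
  sum_eq_one := by
    rw [Fintype.sum_prod_type]
    simp only [linearPartUnits, Fintype.sum_bool, ← Finset.mul_sum, ← add_mul, linearPart_add,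
      one_mul, ← map_sum, sum_single_single_one, map_one]

theorem mul_single_single_one (x : ∀ j, Matrix (κ j) (κ j) ℂ) (j : J) (s u : κ j) :
    x * Pi.single j (Matrix.single s u 1) =
      ∑ r, x j r s • (Pi.single j (Matrix.single r u (1 : ℂ)) : ∀ j, Matrix (κ j) (κ j) ℂ) := by
  ext j' a b
  rcases eq_or_ne j' j with rfl | hj
  · by_cases hub : u = b <;>
      simp [Finset.sum_apply, Matrix.sum_apply, Matrix.mul_apply, Matrix.single_apply, hub]
  · simp [hj]

theorem map_mul_linearPartUnits [IsScalarTower ℝ ℂ R] (x : ∀ j, Matrix (κ j) (κ j) ℂ)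
    (t : J × Bool) (s u : κ t.1) :
    φ x * linearPartUnits φ t s u =
      ∑ r, cond t.2 (x t.1 r s) (starRingEnd ℂ (x t.1 r s)) • linearPartUnits φ t r u := by
  rw [linearPartUnits, ← mul_assoc, map_mul_linearPart, mul_assoc, ← map_mul,
    mul_single_single_one, map_sum, Finset.mul_sum]
  exact Finset.sum_congr rfl fun r _ => linearPart_mul_map_smul φ _ _ _

end MatrixSum

section Frame

variable {T H : Type*} {ι α : T → Type*} [∀ t, DecidableEq (ι t)] [∀ t, Fintype (ι t)]
  [Fintype T] [NormedAddCommGroup H] [InnerProductSpace ℂ H] [CompleteSpace H]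
  {W : ∀ t, ι t → ι t → H →L[ℂ] H} {z : ∀ t, ι t} {v : ∀ t, α t → H}

theorem IsMatrixUnits.inner_apply {ι : Type*} [DecidableEq ι] {W : ι → ι → H →L[ℂ] H}
    (h : IsMatrixUnits W) (r s : ι) (x y : H) : inner ℂ (W r s x) y = inner ℂ x (W s r y) := by
  rw [← h.star_eq r s, ContinuousLinearMap.star_eq_adjoint,
    ContinuousLinearMap.adjoint_inner_right]

theorem exists_orthonormal_range {E : Type*} [NormedAddCommGroup E] [InnerProductSpace ℂ E]
    [FiniteDimensional ℂ E] {P : E →L[ℂ] E} (hP : IsIdempotentElem P) :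
    ∃ (d : ℕ) (v : Fin d → E), Orthonormal ℂ v ∧ (∀ a, P (v a) = v a) ∧
      ∀ y, P y ∈ Submodule.span ℂ (Set.range v) := by
  let V : Submodule ℂ E := LinearMap.range (P : E →ₗ[ℂ] E)
  let v := stdOrthonormalBasis ℂ V
  refine ⟨_, fun a => v a, v.orthonormal.comp_linearIsometry V.subtypeₗᵢ, fun a => ?_, fun y => ?_⟩
  · obtain ⟨y, hy⟩ := (v a).2
    simp only [← hy, ContinuousLinearMap.coe_coe, ← mul_apply_eq_comp, hP.eq]
  · have hy := Submodule.mem_map_of_mem (f := V.subtype) (v.toBasis.mem_span ⟨P y, y, rfl⟩)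
    rwa [Submodule.map_span, ← Set.range_comp, OrthonormalBasis.coe_toBasis] at hy

namespace IsCompleteMatrixUnits

theorem orthonormal (h : IsCompleteMatrixUnits W) (hv : ∀ t, Orthonormal ℂ (v t))
    (hvz : ∀ t a, W t (z t) (z t) (v t a) = v t a) :
    Orthonormal ℂ fun i : Σ t, ι t × α t => W i.1 i.2.1 (z i.1) (v i.1 i.2.2) := by
  classical
  rw [orthonormal_iff_ite]
  rintro ⟨t, r, a⟩ ⟨t', r', a'⟩
  simp only [(h.isMatrixUnits t).inner_apply, ← mul_apply_eq_comp]
  rcases eq_or_ne t t' with rfl | ht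
  · rcases eq_or_ne r r' with rfl | hr
    · simp [(h.isMatrixUnits t).mul_eq, hvz, orthonormal_iff_ite.1 (hv t)]
    · simp [(h.isMatrixUnits t).mul_eq, hr]
  · simp [h.mul_eq_zero ht, ht]

theorem top_le_span (h : IsCompleteMatrixUnits W)
    (hv : ∀ t y, W t (z t) (z t) y ∈ Submodule.span ℂ (Set.range (v t))) :
    ⊤ ≤ Submodule.span ℂ
      (Set.range fun i : Σ t, ι t × α t => W i.1 i.2.1 (z i.1) (v i.1 i.2.2)) := by
  intro y _
  have hy : y = ∑ t, ∑ r, W t r r y := by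
    simpa using (DFunLike.congr_fun h.sum_eq_one y).symm
  rw [hy]
  refine Submodule.sum_mem _ fun t _ => Submodule.sum_mem _ fun r _ => ?_
  have hrr : W t r r y = W t r (z t) (W t (z t) (z t) (W t (z t) r y)) := by
    simp only [← mul_apply_eq_comp, (h.isMatrixUnits t).mul_eq, if_true]
  rw [hrr]
  have hmem := Submodule.mem_map_of_mem (f := (W t r (z t) : H →ₗ[ℂ] H)) (hv t (W t (z t) r y))
  rw [Submodule.map_span, ← Set.range_comp] at hmem
  refine Submodule.span_mono ?_ hmem
  rintro _ ⟨a, rfl⟩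
  exact ⟨⟨t, r, a⟩, rfl⟩

theorem exists_orthonormalBasis [FiniteDimensional ℂ H] [∀ t, Nonempty (ι t)]
    (h : IsCompleteMatrixUnits W) :
    ∃ (d : T → ℕ) (b : OrthonormalBasis (Σ t, ι t × Fin (d t)) ℂ H),
      ∀ t r s a, W t r s (b ⟨t, (s, a)⟩) = b ⟨t, (r, a)⟩ := by
  let z (t : T) : ι t := Classical.arbitrary (ι t)
  have hz (t) : IsIdempotentElem (W t (z t) (z t)) := by
    rw [IsIdempotentElem, (h.isMatrixUnits t).mul_eq, if_pos rfl]
  choose d v hv hvz hspan using fun t => exists_orthonormal_range (hz t)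
  refine ⟨d, .mk (h.orthonormal hv hvz) (h.top_le_span hspan), fun t r s a => ?_⟩
  simp only [OrthonormalBasis.coe_mk, ← mul_apply_eq_comp, (h.isMatrixUnits t).mul_eq, if_true]

end IsCompleteMatrixUnits

end Frame

theorem blockDiagonal_const_eq_zero_iff {o ι α : Type*} [DecidableEq o] [Zero α]
    {a : Matrix ι ι α} : Matrix.blockDiagonal (fun _ : o => a) = 0 ↔ IsEmpty o ∨ a = 0 := by
  have h0 : (Matrix.blockDiagonal fun _ : o => (0 : Matrix ι ι α)) = 0 := Matrix.blockDiagonal_zero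
  rcases isEmpty_or_nonempty o with ho | ho
  · exact iff_of_true (Matrix.ext fun i => isEmptyElim i.2) (.inl ho)
  · rw [← h0, Matrix.blockDiagonal_injective.eq_iff, funext_iff, forall_const]
    exact (or_iff_right (not_isEmpty_iff.2 ho)).symm

section Copies

variable {l : ℕ} {n : Fin l → ℕ} (p q : Fin l → ℕ)

theorem copies_mul (x y : MatrixSum n) : copies p q (x * y) = copies p q x * copies p q y := by
  simp only [copies, ← Matrix.blockDiagonal'_mul, Matrix.fromBlocks_multiply, Matrix.mul_zero,
    Matrix.zero_mul, add_zero, zero_add, ← Matrix.blockDiagonal_mul, Pi.mul_apply, Matrix.map_mul]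

theorem copies_one : copies p q (1 : MatrixSum n) = 1 := by
  have hone (k d : ℕ) :
      (Matrix.blockDiagonal fun _ : Fin d => (1 : Matrix (Fin k) (Fin k) ℂ)) = 1 :=
    Matrix.blockDiagonal_one
  simp only [copies, Pi.one_apply, Matrix.map_one _ (map_zero _) (map_one _), hone,
    Matrix.fromBlocks_one]
  exact Matrix.blockDiagonal'_one

theorem copies_add (x y : MatrixSum n) : copies p q (x + y) = copies p q x + copies p q y := by
  have hadd (k d : ℕ) (a b : Matrix (Fin k) (Fin k) ℂ) :
      (Matrix.blockDiagonal fun _ : Fin d => a + b) =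
        (Matrix.blockDiagonal fun _ : Fin d => a) + Matrix.blockDiagonal fun _ : Fin d => b :=
    Matrix.blockDiagonal_add (fun _ => a) (fun _ => b)
  rw [copies, copies, copies, ← Matrix.blockDiagonal'_add]
  congr 1
  ext1 j
  simp only [Pi.add_apply, Matrix.map_add _ (map_add (starRingEnd ℂ)), hadd,
    Matrix.fromBlocks_add, add_zero]

theorem copies_star (x : MatrixSum n) : copies p q (star x) = star (copies p q x) := by
  simp only [copies, Matrix.star_eq_conjTranspose, Matrix.blockDiagonal'_conjTranspose,
    Matrix.fromBlocks_conjTranspose, Matrix.blockDiagonal_conjTranspose, Matrix.conjTranspose_zero,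
    Pi.star_apply]
  rfl

theorem copies_algebraMap (t : ℝ) :
    copies p q (algebraMap ℝ (MatrixSum n) t) = algebraMap ℝ _ t := by
  simp only [copies, Pi.algebraMap_apply, Matrix.algebraMap_eq_diagonal, Matrix.diagonal_map,
    Matrix.blockDiagonal_diagonal, Matrix.fromBlocks_diagonal, Matrix.blockDiagonal'_diagonal,
    map_zero]
  refine congrArg Matrix.diagonal (funext ?_)
  rintro ⟨j, _ | _⟩
  · rfl
  · exact Complex.conj_ofReal t

variable {p q} in
theorem copies_eq_zero_iff {x : MatrixSum n} :
    copies p q x = 0 ↔ ∀ j, 0 < p j + q j → x j = 0 := by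
  rw [copies, ← Matrix.blockDiagonal'_zero, Matrix.blockDiagonal'_injective.eq_iff, funext_iff]
  refine forall_congr' fun j => ?_
  have hconj : (x j).map (starRingEnd ℂ) = 0 ↔ x j = 0 := by simp [← Matrix.ext_iff]
  rw [Pi.zero_apply, ← Matrix.fromBlocks_zero, Matrix.fromBlocks_inj,
    blockDiagonal_const_eq_zero_iff, blockDiagonal_const_eq_zero_iff, hconj]
  simp only [← Fintype.card_eq_zero_iff, Fintype.card_fin, true_and]
  grind

variable (n) in
theorem card_copyIndex : Fintype.card (CopyIndex n p q) = ∑ j, (p j + q j) * n j := by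
  simp only [CopyIndex, Fintype.card_sigma, Fintype.card_sum, Fintype.card_prod, Fintype.card_fin]
  exact Finset.sum_congr rfl fun j _ => by ring

/-- The map `copies` as a `*`-homomorphism of real algebras. -/
noncomputable def copiesStarAlgHom :
    MatrixSum n →⋆ₐ[ℝ] Matrix (CopyIndex n p q) (CopyIndex n p q) ℂ where
  toFun := copies p q
  map_one' := copies_one p q
  map_mul' := copies_mul p q
  map_zero' := copies_eq_zero_iff.2 fun _ _ => rfl
  map_add' := copies_add p q
  commutes' := copies_algebraMap p q
  map_star' := copies_star p q

/-- Renumbering the basis, as a `*`-isomorphism of matrix algebras. -/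
def reindexStarAlgEquiv {ι κ : Type*} [Fintype ι] [Fintype κ] [DecidableEq ι] [DecidableEq κ]
    (e : ι ≃ κ) : Matrix ι ι ℂ ≃⋆ₐ[ℂ] Matrix κ κ ℂ :=
  .ofAlgEquiv (Matrix.reindexAlgEquiv ℂ ℂ e) fun x => (Matrix.conjTranspose_reindex e e x).symm

variable {p q} in
/-- The `*`-homomorphism `α ↦ U (⊕ⱼ (αⱼ^{⊕ pⱼ} ⊕ ᾱⱼ^{⊕ qⱼ})) Uᴴ`. -/
noncomputable def copiesHom {m : ℕ} (e : CopyIndex n p q ≃ Fin m)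
    (U : Matrix.unitaryGroup (Fin m) ℂ) : MatrixSum n →⋆ₐ[ℝ] Matrix (Fin m) (Fin m) ℂ :=
  ((((reindexStarAlgEquiv e).trans (Unitary.conjStarAlgAut ℂ _ U)).restrictScalars ℝ :
    _ ≃⋆ₐ[ℝ] _) : _ →⋆ₐ[ℝ] _).comp (copiesStarAlgHom p q)

variable {p q} {m : ℕ} (e : CopyIndex n p q ≃ Fin m) (U : Matrix.unitaryGroup (Fin m) ℂ)

variable {e U} in
theorem copiesHom_eq_zero_iff {x : MatrixSum n} :
    copiesHom e U x = 0 ↔ ∀ j, 0 < p j + q j → x j = 0 :=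
  (EmbeddingLike.map_eq_zero_iff (f := (reindexStarAlgEquiv e).trans
    (Unitary.conjStarAlgAut ℂ _ U))).trans copies_eq_zero_iff

end Copies

section Representation

variable {l : ℕ} {n : Fin l → ℕ}

/-- Pairs of a summand and a linearity type, together with a copy of the summand, number the same
basis as `CopyIndex`. -/
def copyIndexEquiv (d : Fin l × Bool → ℕ) :
    (Σ t : Fin l × Bool, Fin (n t.1) × Fin (d t)) ≃
      CopyIndex n (fun j => d (j, true)) (fun j => d (j, false)) where
  toFun
    | ⟨(j, true), a⟩ => ⟨j, Sum.inl a⟩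
    | ⟨(j, false), a⟩ => ⟨j, Sum.inr a⟩
  invFun
    | ⟨j, Sum.inl a⟩ => ⟨(j, true), a⟩
    | ⟨j, Sum.inr a⟩ => ⟨(j, false), a⟩
  left_inv := by rintro ⟨⟨j, _ | _⟩, a⟩ <;> rfl
  right_inv := by rintro ⟨j, a | a⟩ <;> rfl

theorem sum_copies_smul {E : Type*} [AddCommGroup E] [Module ℂ E] {d : Fin l × Bool → ℕ}
    (x : MatrixSum n) (v : CopyIndex n (fun j => d (j, true)) (fun j => d (j, false)) → E)
    (t : Fin l × Bool) (s : Fin (n t.1)) (a : Fin (d t)) :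
    ∑ κ, copies _ _ x κ (copyIndexEquiv d ⟨t, (s, a)⟩) • v κ =
      ∑ r, cond t.2 (x t.1 r s) (starRingEnd ℂ (x t.1 r s)) •
        v (copyIndexEquiv d ⟨t, (r, a)⟩) := by
  obtain ⟨j, _ | _⟩ := t <;>
  · rw [Fintype.sum_sigma, Finset.sum_eq_single j]
    · simp [Fintype.sum_prod_type, copies, Matrix.blockDiagonal'_apply,
        Matrix.blockDiagonal_apply, copyIndexEquiv]
    · intro j' _ hj
      simp [copies, Matrix.blockDiagonal'_apply, copyIndexEquiv, hj]
    · simp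

theorem exists_orthonormalBasis_copies {H : Type*} [NormedAddCommGroup H] [InnerProductSpace ℂ H]
    [FiniteDimensional ℂ H] (hn : ∀ j, 0 < n j) (φ : MatrixSum n →⋆ₐ[ℝ] (H →L[ℂ] H)) :
    ∃ (p q : Fin l → ℕ) (b : OrthonormalBasis (CopyIndex n p q) ℂ H),
      ∀ x κ, φ x (b κ) = ∑ κ', copies p q x κ' κ • b κ' := by
  have (t : Fin l × Bool) : Nonempty (Fin (n t.1)) := ⟨⟨0, hn t.1⟩⟩
  obtain ⟨d, b, hb⟩ := (isCompleteMatrixUnits_linearPartUnits φ).exists_orthonormalBasis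
  refine ⟨_, _, b.reindex (copyIndexEquiv d), fun x κ => ?_⟩
  obtain ⟨⟨t, s, a⟩, rfl⟩ := (copyIndexEquiv d).surjective κ
  have hx := DFunLike.congr_fun (map_mul_linearPartUnits φ x t s s) (b ⟨t, (s, a)⟩)
  rw [mul_apply_eq_comp, hb] at hx
  simpa only [sum_copies_smul, OrthonormalBasis.reindex_apply, Equiv.symm_apply_apply,
    sum_apply, smul_apply, hb] using hx

theorem exists_unitary_eq_conj_reindex {ι κ : Type*} [Fintype ι] [Fintype κ] [DecidableEq κ]
    (b : OrthonormalBasis ι ℂ (EuclideanSpace ℂ κ)) (e : ι ≃ κ) :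
    ∃ U : Matrix.unitaryGroup κ ℂ, ∀ (M : Matrix κ κ ℂ) (N : Matrix ι ι ℂ),
      (∀ i, Matrix.toEuclideanCLM (𝕜 := ℂ) M (b i) = ∑ i', N i' i • b i') →
        M = (U : Matrix κ κ ℂ) * Matrix.reindex e e N * (U : Matrix κ κ ℂ)ᴴ := by
  let U : Matrix κ κ ℂ := (EuclideanSpace.basisFun κ ℂ).toBasis.toMatrix (b.reindex e)
  have hU : U ∈ Matrix.unitaryGroup κ ℂ :=
    OrthonormalBasis.toMatrix_orthonormalBasis_mem_unitary _ _
  have hU_apply (r c) : U r c = b (e.symm c) r := by simp [U, Module.Basis.toMatrix_apply]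
  refine ⟨⟨U, hU⟩, fun M N h => ?_⟩
  have hMU : M * U = U * Matrix.reindex e e N := by
    ext r c
    have hrc := congrArg (fun v : EuclideanSpace ℂ κ => v r) (h (e.symm c))
    rw [Matrix.mul_apply, Matrix.mul_apply, ← e.sum_comp fun k => U r k * _]
    simpa [hU_apply, Matrix.mulVec, dotProduct, mul_comm] using hrc
  rw [← hMU, mul_assoc, ← Matrix.star_eq_conjTranspose, Matrix.mem_unitaryGroup_iff.1 hU, mul_one]

theorem exists_eq_copiesHom {m : ℕ} (hn : ∀ j, 0 < n j)
    (φ : MatrixSum n →⋆ₐ[ℝ] Matrix (Fin m) (Fin m) ℂ) :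
    ∃ (p q : Fin l → ℕ) (e : CopyIndex n p q ≃ Fin m) (U : Matrix.unitaryGroup (Fin m) ℂ),
      φ = copiesHom e U := by
  let T : Matrix (Fin m) (Fin m) ℂ →⋆ₐ[ℝ]
      (EuclideanSpace ℂ (Fin m) →L[ℂ] EuclideanSpace ℂ (Fin m)) :=
    ((Matrix.toEuclideanCLM (𝕜 := ℂ) (n := Fin m)).restrictScalars ℝ : _ ≃⋆ₐ[ℝ] _)
  obtain ⟨p, q, b, hb⟩ := exists_orthonormalBasis_copies hn (T.comp φ)
  have hcard : Fintype.card (CopyIndex n p q) = Fintype.card (Fin m) := by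
    rw [← Module.finrank_eq_card_basis b.toBasis]; simp
  let e : CopyIndex n p q ≃ Fin m := Fintype.equivOfCardEq hcard
  obtain ⟨U, hU⟩ := exists_unitary_eq_conj_reindex b e
  exact ⟨p, q, e, U, StarAlgHom.ext fun x => hU _ _ (hb x)⟩

end Representation

theorem isUnit_map_iff_of_injective {R S F : Type*} [Ring R] [IsArtinianRing R] [Ring S]
    [FunLike F R S] [RingHomClass F R S] {f : F} (hf : Function.Injective f) {x : R} :
    IsUnit (f x) ↔ IsUnit x := by
  refine ⟨fun h => IsArtinianRing.isUnit_iff_isRegular.2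
    ⟨fun y z hyz => hf ?_, fun y z hyz => hf ?_⟩, fun h => h.map f⟩
  · exact h.mul_left_cancel (by simpa using congrArg f hyz)
  · exact h.mul_right_cancel (by simpa using congrArg f hyz)

section RealStarHom

variable {𝒜 ℬ : Type*} [CStarAlgebra 𝒜] [CStarAlgebra ℬ]

theorem spectrum_map_eq_of_injective [FiniteDimensional ℂ 𝒜] {f : 𝒜 →⋆ₐ[ℝ] ℬ}
    (hf : Function.Injective f) {a : 𝒜} (ha : IsSelfAdjoint a) :
    spectrum ℂ (f a) = spectrum ℂ a := by
  have : IsArtinianRing 𝒜 := IsArtinianRing.of_finite ℂ 𝒜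
  rw [← ha.spectrumRestricts.algebraMap_image, ← (ha.map f).spectrumRestricts.algebraMap_image]
  congr 1
  ext t
  rw [spectrum.mem_iff, spectrum.mem_iff, ← AlgHomClass.commutes f, ← map_sub,
    isUnit_map_iff_of_injective hf]

/-- The restriction of a real `*`-homomorphism to the special JB algebras of all self-adjoint
elements. -/
noncomputable def selfAdjointRestrict (f : 𝒜 →⋆ₐ[ℝ] ℬ) (a : (SpecialJBAlgebra.full 𝒜).Elt) :
    (SpecialJBAlgebra.full ℬ).Elt :=
  ⟨f a, IsSelfAdjoint.map a.2 f⟩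

theorem isEncoding_selfAdjointRestrict [FiniteDimensional ℂ 𝒜] {f : 𝒜 →⋆ₐ[ℝ] ℬ}
    (hf : Function.Injective f) : IsEncoding (selfAdjointRestrict f) where
  spectrum_eq a := spectrum_map_eq_of_injective hf a.2
  convex a₁ a₂ t _ _ := Subtype.ext <|
    show f (t • (a₁ : 𝒜) + (1 - t) • (a₂ : 𝒜)) = t • f a₁ + (1 - t) • f a₂ by
      rw [map_add, map_smul, map_smul]

/-- A `*`-preserving ring homomorphism that extends an encoding, as a homomorphism of real
algebras. -/
noncomputable def IsEncoding.starAlgHomOfExtends {A : SpecialJBAlgebra 𝒜} {B : SpecialJBAlgebra ℬ}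
    {γ : A.Elt → B.Elt} (h : IsEncoding γ) (Γ : 𝒜 →+* ℬ) (hΓ : ∀ a : A.Elt, Γ a = γ a)
    (hs : ∀ x, Γ (star x) = star (Γ x)) : 𝒜 →⋆ₐ[ℝ] ℬ where
  toRingHom := Γ
  commutes' t := by
    have ht : algebraMap ℝ 𝒜 t ∈ A.toSubmodule := by
      rw [Algebra.algebraMap_eq_smul_one]
      exact A.smul_mem t A.one_mem'
    exact (hΓ ⟨_, ht⟩).trans (h.map_eq_algebraMap_iff.2 rfl)
  map_star' := hs

theorem IsEncoding.injective_of_extends {B : SpecialJBAlgebra ℬ}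
    {γ : (SpecialJBAlgebra.full 𝒜).Elt → B.Elt} (h : IsEncoding γ) {Γ : 𝒜 →⋆ₐ[ℝ] ℬ}
    (hΓ : ∀ a : (SpecialJBAlgebra.full 𝒜).Elt, Γ a = γ a) : Function.Injective Γ := by
  refine (injective_iff_map_eq_zero Γ).2 fun x hx => CStarRing.star_mul_self_eq_zero_iff x |>.1 ?_
  let a : (SpecialJBAlgebra.full 𝒜).Elt := ⟨star x * x, .star_mul_self x⟩
  have ha : (γ a : ℬ) = 0 := by rw [← hΓ, map_mul, hx, mul_zero]
  exact congrArg Subtype.val (h.map_eq_zero_iff.1 (Subtype.ext ha))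

end RealStarHom

section Decomposition

variable {𝒜 ℬ : Type*} [CStarAlgebra 𝒜] [CStarAlgebra ℬ] {l k : ℕ} {n : Fin l → ℕ}
  {m : Fin k → ℕ} {Φ : 𝒜 ≃⋆ₐ[ℂ] MatrixSum n} {Ψ : ℬ ≃⋆ₐ[ℂ] MatrixSum m}

theorem finiteDimensional_of_matrixSum (Φ : 𝒜 ≃⋆ₐ[ℂ] MatrixSum n) : FiniteDimensional ℂ 𝒜 :=
  .of_surjective (Φ.symm.toAlgEquiv.toLinearMap : MatrixSum n →ₗ[ℂ] 𝒜) Φ.symm.surjective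

theorem hasCopiesForm_iff {p q : Fin k → Fin l → ℕ} {Γ : 𝒜 → ℬ} :
    HasCopiesForm Φ Ψ p q Γ ↔
      ∃ (e : ∀ i, CopyIndex n (p i) (q i) ≃ Fin (m i))
        (U : ∀ i, Matrix.unitaryGroup (Fin (m i)) ℂ),
        ∀ x i, Ψ (Γ x) i = copiesHom (e i) (U i) (Φ x) :=
  ⟨fun ⟨e, U, hU, h⟩ => ⟨e, fun i => ⟨U i, hU i⟩, h⟩,
    fun ⟨e, U, h⟩ => ⟨e, fun i => U i, fun i => (U i).2, h⟩⟩

theorem exists_hasCopiesForm_of_starAlgHom (hn : ∀ j, 0 < n j) (Φ : 𝒜 ≃⋆ₐ[ℂ] MatrixSum n)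
    (Ψ : ℬ ≃⋆ₐ[ℂ] MatrixSum m) (Γ : 𝒜 →⋆ₐ[ℝ] ℬ) :
    ∃ p q : Fin k → Fin l → ℕ,
      (∀ i, ∑ j, (p i j + q i j) * n j = m i) ∧ HasCopiesForm Φ Ψ p q Γ := by
  let Φ' : MatrixSum n →⋆ₐ[ℝ] 𝒜 := (Φ.symm.restrictScalars ℝ : MatrixSum n ≃⋆ₐ[ℝ] 𝒜)
  let Ψ' : ℬ →⋆ₐ[ℝ] MatrixSum m := (Ψ.restrictScalars ℝ : ℬ ≃⋆ₐ[ℝ] MatrixSum m)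
  choose p q e U h using fun i => exists_eq_copiesHom hn
    ((Pi.evalStarAlgHom ℝ _ i).comp (Ψ'.comp (Γ.comp Φ')))
  refine ⟨p, q, fun i => ?_, hasCopiesForm_iff.2 ⟨e, U, fun x i => ?_⟩⟩
  · rw [← card_copyIndex, Fintype.card_congr (e i), Fintype.card_fin]
  · rw [← h]
    exact congrFun (congrArg (fun y => Ψ (Γ y)) (Φ.symm_apply_apply x).symm) i

theorem exists_hasCopiesForm {p q : Fin k → Fin l → ℕ} (Φ : 𝒜 ≃⋆ₐ[ℂ] MatrixSum n)
    (Ψ : ℬ ≃⋆ₐ[ℂ] MatrixSum m) (hm : ∀ i, ∑ j, (p i j + q i j) * n j = m i) :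
    ∃ Γ : 𝒜 → ℬ, HasCopiesForm Φ Ψ p q Γ := by
  let e (i) : CopyIndex n (p i) (q i) ≃ Fin (m i) :=
    Fintype.equivFinOfCardEq (by rw [card_copyIndex, hm])
  refine ⟨fun x => Ψ.symm fun i => copiesHom (e i) 1 (Φ x),
    hasCopiesForm_iff.2 ⟨e, 1, fun x i => ?_⟩⟩
  rw [StarAlgEquiv.apply_symm_apply, Pi.one_apply]

theorem HasCopiesForm.map_eq_zero_iff {p q : Fin k → Fin l → ℕ} {Γ : 𝒜 → ℬ}
    (h : HasCopiesForm Φ Ψ p q Γ) {x : 𝒜} :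
    Γ x = 0 ↔ ∀ i j, 0 < p i j + q i j → Φ x j = 0 := by
  obtain ⟨e, U, h⟩ := hasCopiesForm_iff.1 h
  rw [← EmbeddingLike.map_eq_zero_iff (f := Ψ), funext_iff]
  simp only [h, Pi.zero_apply, copiesHom_eq_zero_iff]

theorem HasCopiesForm.exists_starAlgHom {p q : Fin k → Fin l → ℕ} {Γ : 𝒜 → ℬ}
    (h : HasCopiesForm Φ Ψ p q Γ) : ∃ Γ' : 𝒜 →⋆ₐ[ℝ] ℬ, ⇑Γ' = Γ := by
  obtain ⟨e, U, h⟩ := hasCopiesForm_iff.1 h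
  let Φ' : 𝒜 →⋆ₐ[ℝ] MatrixSum n := (Φ.restrictScalars ℝ : 𝒜 ≃⋆ₐ[ℝ] MatrixSum n)
  let Ψ' : MatrixSum m →⋆ₐ[ℝ] ℬ := (Ψ.symm.restrictScalars ℝ : MatrixSum m ≃⋆ₐ[ℝ] ℬ)
  let C : MatrixSum n →⋆ₐ[ℝ] MatrixSum m :=
    { AlgHom.pi fun i => (copiesHom (e i) (U i)).toAlgHom with
      map_star' := fun x => funext fun i => map_star (copiesHom (e i) (U i)) x }
  refine ⟨Ψ'.comp (C.comp Φ'), funext fun x => ?_⟩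
  exact (congrArg Ψ.symm (funext fun i => (h x i).symm)).trans (Ψ.symm_apply_apply _)

theorem HasCopiesForm.injective_iff (hn : ∀ j, 0 < n j) {p q : Fin k → Fin l → ℕ}
    {Γ : 𝒜 →⋆ₐ[ℝ] ℬ} (h : HasCopiesForm Φ Ψ p q Γ) :
    Function.Injective Γ ↔ ∀ j, ∃ i, 0 < p i j + q i j := by
  refine ⟨fun hΓ => ?_, fun hpq => (injective_iff_map_eq_zero Γ).2 fun x hx => ?_⟩
  · by_contra! ⟨j, hj⟩
    have : Nonempty (Fin (n j)) := ⟨⟨0, hn j⟩⟩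
    have hzero : Γ (Φ.symm (Pi.single j 1)) = 0 := h.map_eq_zero_iff.2 fun i j' hij' => by
      rw [StarAlgEquiv.apply_symm_apply]
      exact Pi.single_eq_of_ne (by rintro rfl; exact (hj i).not_gt hij') _
    rw [_root_.map_eq_zero_iff Γ hΓ, EmbeddingLike.map_eq_zero_iff, Pi.single_eq_zero_iff] at hzero
    exact one_ne_zero hzero
  · refine (EmbeddingLike.map_eq_zero_iff (f := Φ)).1 (funext fun j => ?_)
    obtain ⟨i, hij⟩ := hpq j
    exact h.map_eq_zero_iff.1 hx i j hij

theorem exists_starAlgHom_eq_of_isEncoding (Φ : 𝒜 ≃⋆ₐ[ℂ] MatrixSum n) {B : SpecialJBAlgebra ℬ}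
    {γ : (SpecialJBAlgebra.full 𝒜).Elt → B.Elt} (h : IsEncoding γ) :
    ∃ Γ : 𝒜 →⋆ₐ[ℝ] ℬ, ∀ a : (SpecialJBAlgebra.full 𝒜).Elt, Γ a = γ a := by
  have := finiteDimensional_of_matrixSum Φ
  obtain ⟨θ, hθ, hθγ⟩ := h.exists_isJordanStarHom
  let θ' : MatrixSum n →ₗ[ℂ] ℬ := θ ∘ₗ (Φ.symm.toAlgEquiv.toLinearMap : MatrixSum n →ₗ[ℂ] 𝒜)
  have hθ' (x) : θ' x = θ (Φ.symm x) := rfl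
  have hJordan : IsJordanStarHom θ' :=
    { map_mul_self := fun x => by rw [hθ', hθ', map_mul, hθ.map_mul_self]
      map_star := fun x => by rw [hθ', hθ', map_star, hθ.map_star] }
  have hone : θ' 1 = 1 := by
    rw [hθ', map_one, ← map_one (algebraMap ℝ ℬ)]
    exact (hθγ ⟨1, .one 𝒜⟩).trans (h.map_eq_algebraMap_iff.2 (map_one (algebraMap ℝ 𝒜)).symm)
  obtain ⟨Γ, hΓ⟩ := hJordan.exists_starAlgHom hone
  let Φ' : 𝒜 →⋆ₐ[ℝ] MatrixSum n := (Φ.restrictScalars ℝ : 𝒜 ≃⋆ₐ[ℝ] MatrixSum n)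
  refine ⟨Γ.comp Φ', fun a => (hΓ _ (IsSelfAdjoint.map a.2 Φ)).trans ?_⟩
  rw [hθ', StarAlgEquiv.symm_apply_apply, hθγ]

theorem ringHom_ext_of_selfAdjoint {R : Type*} [NonAssocSemiring R] (Φ : 𝒜 ≃⋆ₐ[ℂ] MatrixSum n)
    (hn : ∀ j, 0 < n j) {f g : 𝒜 →+* R} (h : ∀ a, IsSelfAdjoint a → f a = g a)
    (h' : ∀ j, n j = 1 → ∀ z, f (Φ.symm (Pi.single j z)) = g (Φ.symm (Pi.single j z))) :
    f = g := by
  have hfg : f.comp (Φ.symm : MatrixSum n →+* 𝒜) = g.comp (Φ.symm : MatrixSum n →+* 𝒜) :=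
    ringHom_matrixSum_ext_of_selfAdjoint (fun a ha => h _ (ha.map Φ.symm)) fun j hj z =>
      h' j ((Fin.subsingleton_iff_le_one.1 hj).antisymm (hn j)) z
  refine RingHom.ext fun x => ?_
  simpa using DFunLike.congr_fun hfg (Φ x)

theorem map_star_of_map_star_single {R : Type*} [Semiring R] [StarRing R]
    (Φ : 𝒜 ≃⋆ₐ[ℂ] MatrixSum n) (hn : ∀ j, 0 < n j) {Γ : 𝒜 →+* R}
    (hsa : ∀ a, IsSelfAdjoint a → IsSelfAdjoint (Γ a))
    (h1 : ∀ j, n j = 1 → ∀ z : Matrix (Fin (n j)) (Fin (n j)) ℂ,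
      Γ (star (Φ.symm (Pi.single j z))) = star (Γ (Φ.symm (Pi.single j z)))) (x : 𝒜) :
    Γ (star x) = star (Γ x) := by
  have hstar : Γ = starConj Γ := by
    refine ringHom_ext_of_selfAdjoint Φ hn (fun a ha => ?_) fun j hj z => ?_
    · rw [starConj_apply, ha.star_eq, (hsa a ha).star_eq]
    · rw [starConj_apply, h1 j hj z, star_star]
  rw [DFunLike.congr_fun hstar (star x), starConj_apply, star_star]

end Decomposition

theorem mainTheorem2 {𝒜 ℬ : Type*} [CStarAlgebra 𝒜] [CStarAlgebra ℬ]
    {l k : ℕ} (n : Fin l → ℕ) (m : Fin k → ℕ)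
    (hn : ∀ j, 0 < n j) (hm : ∀ i, 0 < m i)
    (Φ : 𝒜 ≃⋆ₐ[ℂ] MatrixSum n) (Ψ : ℬ ≃⋆ₐ[ℂ] MatrixSum m) :
    (∀ (A : SpecialJBAlgebra 𝒜) (B : SpecialJBAlgebra ℬ) (γ : A.Elt → B.Elt), IsEncoding γ →
      -- form of the extended encodings
      (∀ Γ : 𝒜 →+* ℬ, (∀ a : A.Elt, Γ a = γ a) → (∀ x, Γ (star x) = star (Γ x)) →
        ∃ p q : Fin k → Fin l → ℕ,
          (∀ i, ∑ j, (p i j + q i j) * n j = m i) ∧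
          HasCopiesForm Φ Ψ p q Γ ∧
          (A = SpecialJBAlgebra.full 𝒜 → ∀ j, ∃ i, 0 < p i j + q i j)) ∧
      -- existence, compatibility with the involution, and uniqueness of the extension
      (A = SpecialJBAlgebra.full 𝒜 →
        (∃ Γ : 𝒜 →+* ℬ, (∀ a : A.Elt, Γ a = γ a) ∧ ∀ x, Γ (star x) = star (Γ x)) ∧
        (∀ Γ : 𝒜 →+* ℬ, (∀ a : A.Elt, Γ a = γ a) →
          (∀ j, n j = 1 → ∀ z : Matrix (Fin (n j)) (Fin (n j)) ℂ,
            Γ (star (Φ.symm (Pi.single j z))) = star (Γ (Φ.symm (Pi.single j z)))) →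
          ∀ x, Γ (star x) = star (Γ x)) ∧
        ((∀ j, 2 ≤ n j) → ∃! Γ : 𝒜 →+* ℬ, ∀ a : A.Elt, Γ a = γ a))) ∧
    -- conversely, all multiplicities occur, and every map of this form is an extended encoding
    (∀ p q : Fin k → Fin l → ℕ,
      (∀ i, ∑ j, (p i j + q i j) * n j = m i) → (∀ j, ∃ i, 0 < p i j + q i j) →
      (∃ Γ : 𝒜 → ℬ, HasCopiesForm Φ Ψ p q Γ) ∧
      ∀ Γ : 𝒜 → ℬ, HasCopiesForm Φ Ψ p q Γ →
        ∃ Γ' : 𝒜 →+* ℬ, (∀ x, Γ' x = Γ x) ∧ (∀ x, Γ' (star x) = star (Γ' x)) ∧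
          ∃ γ : (SpecialJBAlgebra.full 𝒜).Elt → (SpecialJBAlgebra.full ℬ).Elt,
            IsEncoding γ ∧ ∀ a, (γ a : ℬ) = Γ a) := by
  refine ⟨fun A B γ hγ => ⟨fun Γ hΓ hs => ?_, ?_⟩, fun p q hpq hpos =>
    ⟨exists_hasCopiesForm Φ Ψ hpq, fun Γ hform => ?_⟩⟩
  · obtain ⟨p, q, hpq, hform⟩ :=
      exists_hasCopiesForm_of_starAlgHom hn Φ Ψ (hγ.starAlgHomOfExtends Γ hΓ hs)
    refine ⟨p, q, hpq, hform, ?_⟩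
    rintro rfl
    exact (hform.injective_iff hn).1 (hγ.injective_of_extends hΓ)
  · rintro rfl
    obtain ⟨Γ₀, hΓ₀⟩ := exists_starAlgHom_eq_of_isEncoding Φ hγ
    refine ⟨⟨Γ₀, hΓ₀, map_star Γ₀⟩, fun Γ hΓ h1 => ?_, fun h2 => ⟨Γ₀, hΓ₀, fun Γ hΓ => ?_⟩⟩
    · exact map_star_of_map_star_single Φ hn (fun a ha => hΓ ⟨a, ha⟩ ▸ B.isSelfAdjoint' (γ _).2) h1
    · exact ringHom_ext_of_selfAdjoint Φ hn (fun a ha => (hΓ ⟨a, ha⟩).trans (hΓ₀ ⟨a, ha⟩).symm)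
        fun j hj => absurd (h2 j) (by lia)
  · have := finiteDimensional_of_matrixSum Φ
    obtain ⟨Γ', rfl⟩ := hform.exists_starAlgHom
    exact ⟨Γ', fun _ => rfl, map_star Γ', selfAdjointRestrict Γ',
      isEncoding_selfAdjointRestrict ((hform.injective_iff hn).2 hpos), fun _ => rfl⟩
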